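/- **Proposition 5.5 (no subtree size limit for $\mu^{(2)}$).** Let $C:=2\int_0^{1/2}\sin(\log x)\,dx$ and let $\mu^{(1)}$ be the measure on $[0,1]^2$ with density $$f(x,y)=\begin{cases}1+\sin(\log x)&(x,y)\in(0,\tfrac12)\times(0,\tfrac12),\\ 1-\sin(\log x)&(x,y)\in(0,\tfrac12)\times(\tfrac12,1),\\ 1-C&(x,y)\in(\tfrac12,1)\times(0,\tfrac12),\\ 1+C&(x,y)\in(\tfrac12,1)\times(\tfrac12,1).\end{cases}$$ Let $\mu^{(2)}$ be the sum of the image of Lebesgue measure on $[0,\tfrac12]$ under $t\mapsto(t,\tfrac12+t)$ and of $\tfrac12$ times the image of $\mu^{(1)}$ under $(x,y)\mapsto(\tfrac{x+1}2,\tfrac y2)$. Then: 1. $\mu^{(1)}$ and $\mu^{(2)}$ are permutons, i.e. both of their marginals are the uniform measure on $[0,1]$. 2. $\mu^{(2)}$ gives mass $\tfrac12$ to the segment from $(0,\tfrac12)$ to $(\tfrac12,1)$; its restriction to $[\tfrac12,1]\times[0,\tfrac12]$ is $\tfrac12$ times the image of $\mu^{(1)}$ under $(x,y)\mapsto(\tfrac{x+1}2,\tfrac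 y2)$; and for every bounded measurable $h$, $$\int h\,d\mu^{(2)}=\int_0^{1/2}h(t,\tfrac12+t)\,dt+\int \tfrac12\,h\big(\tfrac{x+1}2,\tfrac y2\big)\,\mu^{(1)}(dx,dy).$$ 3. As $x\to0^+$, the measures $\frac1x\,\mu^{(2)}([0,x]\times\cdot)$ converge weakly to $\delta_{1/2}$. 4. For $n\ge 1$ let $T_n$ be the binary search tree obtained by taking $n$ i.i.d. points with law $\mu^{(2)}$ and inserting their ordinates, in the order of increasing abscissae, into an initially empty tree. Identify the nodes with finite words over $\{0,1\}$ ($0$ = left child, $1$ = right child), and let $t(T_n,v)$ be the proportion of nodes of $T_n$ having the word $v$ as a prefix. Then, as $n\to\infty$, $T_n$ does not converge in distribution for the subtree size topology: there is no random function $\psi:\{0,1\}^*\to\mathbb R$ such that $(t(T_n,v))_{v\in\{0,1\}^*}$ converges in distribution to $(\psi(v))_{v\in\{0,1\}^*}$ in the topology of pointwise convergence. -/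

import Mathlib

open MeasureTheory Filter Topology
open scoped ENNReal BoundedContinuousFunction

/-! ### Binary search trees and subtree proportions -/

/-- Insertion of a real number into a labelled binary tree by the binary-search rule. -/
noncomputable def bstInsert (x : ℝ) : BinaryTree ℝ → BinaryTree ℝ
  | .nil => .node x .nil .nil
  | .node a l r => if x < a then .node a (bstInsert x l) r else .node a l (bstInsert x r)

/-- The binary search tree of a finite sequence: its entries are inserted one after the other,
starting from the empty tree. -/
noncomputable def bst (ys : List ℝ) : BinaryTree ℝ :=
  ys.foldl (fun T y => bstInsert y T) .nil

/-- The set of nodes of a binary tree, as finite words over `{0, 1}`, with `0 = false` (left child)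
and `1 = true` (right child); the empty word is the root. -/
def treeNodes {α : Type*} : BinaryTree α → Finset (List Bool)
  | .nil => ∅
  | .node _ l r =>
      insert [] ((treeNodes l).image (List.cons false) ∪ (treeNodes r).image (List.cons true))

/-- `t(T, v)`: the proportion of the nodes of `T` that have the word `v` as a prefix. -/
noncomputable def subtreeProportion {α : Type*} (T : BinaryTree α) (v : List Bool) : ℝ :=
  (((treeNodes T).filter (fun u => v <+: u)).card : ℝ) / ((treeNodes T).card : ℝ)

/-- The ordinates of the points `ω 0, …, ω (n - 1)`, listed by increasing abscissa. -/
noncomputable def sortedOrdinates {n : ℕ} (ω : Fin n → ℝ × ℝ) : List ℝ :=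
  List.ofFn fun i => (ω (Tuple.sort (fun j => (ω j).1) i)).2

/-- The binary search tree of a finite family of points in the plane. -/
noncomputable def bstOfPoints {n : ℕ} (ω : Fin n → ℝ × ℝ) : BinaryTree ℝ :=
  bst (sortedOrdinates ω)

/-- The function `v ↦ t(T, v)` for the binary search tree `T` of a finite family of points. -/
noncomputable def subtreeProfile (n : ℕ) (ω : Fin n → ℝ × ℝ) : List Bool → ℝ :=
  fun v => subtreeProportion (bstOfPoints ω) v

/-! The profile is a measurable function of the points, so that it has a law. -/

theorem exists_tree_bst {n : ℕ} (y z : Fin n → ℝ) (h : ∀ i j, y i < y j ↔ z i < z j)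
    (l : List (Fin n)) :
    ∃ T : BinaryTree (Fin n), bst (l.map y) = T.map y ∧ bst (l.map z) = T.map z := by
  have ins : ∀ (i : Fin n) (T : BinaryTree (Fin n)), ∃ T' : BinaryTree (Fin n),
      bstInsert (y i) (T.map y) = T'.map y ∧ bstInsert (z i) (T.map z) = T'.map z := by
    intro i T
    induction T with
    | nil => exact ⟨.node i .nil .nil, rfl, rfl⟩
    | node a l r hl hr =>
      obtain ⟨l', h1, h2⟩ := hl
      obtain ⟨r', h3, h4⟩ := hr
      by_cases hc : y i < y a
      · refine ⟨.node a l' r, ?_, ?_⟩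
        · simp [BinaryTree.map, bstInsert, hc, h1]
        · simp [BinaryTree.map, bstInsert, (h i a).1 hc, h2]
      · refine ⟨.node a l r', ?_, ?_⟩
        · simp [BinaryTree.map, bstInsert, hc, h3]
        · simp [BinaryTree.map, bstInsert, mt (h i a).2 hc, h4]
  induction l using List.reverseRecOn with
  | nil => exact ⟨.nil, rfl, rfl⟩
  | append_singleton l i ih =>
    obtain ⟨T, h1, h2⟩ := ih
    obtain ⟨T', h3, h4⟩ := ins i T
    refine ⟨T', ?_, ?_⟩
    · rw [← h3, ← h1]; simp [bst]
    · rw [← h4, ← h2]; simp [bst]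

theorem treeNodes_map {α β : Type*} (f : α → β) (T : BinaryTree α) :
    treeNodes (T.map f) = treeNodes T := by
  induction T with
  | nil => rfl
  | node a l r hl hr => simp [BinaryTree.map, treeNodes, hl, hr]

theorem measurable_subtreeProfile (n : ℕ) : Measurable (subtreeProfile n) := by
  classical
  let p : (Fin n → ℝ × ℝ) → (Fin n → Fin n → Bool) × (Fin n → Fin n → Bool) := fun ω =>
    (fun i j => decide ((ω i).1 ≤ (ω j).1), fun i j => decide ((ω i).2 < (ω j).2))
  have hp : Measurable p := by
    refine Measurable.prodMk ?_ ?_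
    · refine measurable_pi_lambda _ fun i => measurable_pi_lambda _ fun j => ?_
      refine measurable_to_bool ?_
      have : (fun ω : Fin n → ℝ × ℝ => decide ((ω i).1 ≤ (ω j).1)) ⁻¹' {true}
          = {ω | (ω i).1 ≤ (ω j).1} := by ext; simp
      rw [this]
      exact measurableSet_le (by fun_prop) (by fun_prop)
    · refine measurable_pi_lambda _ fun i => measurable_pi_lambda _ fun j => ?_
      refine measurable_to_bool ?_
      have : (fun ω : Fin n → ℝ × ℝ => decide ((ω i).2 < (ω j).2)) ⁻¹' {true}
          = {ω | (ω i).2 < (ω j).2} := by ext; simp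
      rw [this]
      exact measurableSet_lt (by fun_prop) (by fun_prop)
  have key : Function.FactorsThrough (subtreeProfile n) p := by
    intro ω ω' h
    have hx : ∀ i j, (ω i).1 ≤ (ω j).1 ↔ (ω' i).1 ≤ (ω' j).1 := fun i j => by
      simpa [p] using congrFun (congrFun (congrArg Prod.fst h) i) j
    have hy : ∀ i j, (ω i).2 < (ω j).2 ↔ (ω' i).2 < (ω' j).2 := fun i j => by
      simpa [p] using congrFun (congrFun (congrArg Prod.snd h) i) j
    have hs : Tuple.sort (fun j => (ω j).1) = Tuple.sort (fun j => (ω' j).1) := by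
      rw [Tuple.eq_sort_iff]
      obtain ⟨h1, h2⟩ := (Tuple.eq_sort_iff (f := fun j => (ω j).1)).1 rfl
      refine ⟨fun i j hij => (hx _ _).1 (h1 hij), fun i j hij he => h2 i j hij ?_⟩
      exact le_antisymm ((hx _ _).2 he.le) ((hx _ _).2 he.ge)
    have hl : ∀ ω₀ : Fin n → ℝ × ℝ, sortedOrdinates ω₀ =
        (List.ofFn (Tuple.sort (fun j => (ω₀ j).1))).map (fun i => (ω₀ i).2) := fun ω₀ => by
      rw [List.map_ofFn]; rfl
    obtain ⟨T, h1, h2⟩ := exists_tree_bst (fun i => (ω i).2) (fun i => (ω' i).2) hy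
      (List.ofFn (Tuple.sort (fun j => (ω j).1)))
    funext v
    simp only [subtreeProfile, bstOfPoints, subtreeProportion]
    rw [hl ω, hl ω', ← hs, h1, h2, treeNodes_map, treeNodes_map]
  have : subtreeProfile n = (Function.extend p (subtreeProfile n) 0) ∘ p := by
    funext ω; exact (key.extend_apply 0 ω).symm
  rw [this]
  exact (measurable_of_finite _).comp hp

/-! ### Convergence -/

/-- Weak convergence of (finite) measures, tested against bounded continuous functions. -/
def WeaklyConverges {ι E : Type*} [TopologicalSpace E] [MeasurableSpace E]
    (m : ι → Measure E) (l : Filter ι) (m₀ : Measure E) : Prop :=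
  ∀ f : E →ᵇ ℝ, Tendsto (fun i => ∫ x, f x ∂(m i)) l (𝓝 (∫ x, f x ∂m₀))

/-- The law, on the space of functions `{0,1}* → ℝ`, of `v ↦ t(T, v)` for the binary search
tree `T` of `n` independent points with law `μ`. -/
noncomputable def subtreeProfileLaw (μ : Measure (ℝ × ℝ)) (n : ℕ) : Measure (List Bool → ℝ) :=
  (Measure.pi fun _ : Fin n => μ).map (subtreeProfile n)

/-- The binary search trees of `n` i.i.d. points with law `μ` converge in distribution, as
`n → ∞`, for the subtree size topology, i.e. the topology of pointwise convergence of
`v ↦ t(T, v)`. The limit is a random function `ψ` on words with law `ν`. It need not be required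
that almost surely `ψ ∅ = 1` and `ψ v = ψ (v0) + ψ (v1)`: this passes to the limit by itself,
since `t(T, v) - t(T, v0) - t(T, v1)` is `0` or `1 / n`. -/
def SubtreeSizeConverges (μ : Measure (ℝ × ℝ)) : Prop :=
  ∃ ν : Measure (List Bool → ℝ), IsProbabilityMeasure ν ∧
    WeaklyConverges (subtreeProfileLaw μ) atTop ν

/-! ### Permutons -/

/-- A permuton: a measure on the plane both of whose marginals are the uniform law on `[0,1]`
(so it is a probability measure carried by the unit square). -/
def IsPermuton (μ : Measure (ℝ × ℝ)) : Prop :=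
  μ.map Prod.fst = volume.restrict (Set.Icc 0 1) ∧ μ.map Prod.snd = volume.restrict (Set.Icc 0 1)

/-- The measure `A ↦ μ([0,x] × A) / x`. -/
noncomputable def leftEdgeMeasure (μ : Measure (ℝ × ℝ)) (x : ℝ) : Measure ℝ :=
  (ENNReal.ofReal x)⁻¹ • (μ.restrict (Set.Icc 0 x ×ˢ Set.univ)).map Prod.snd

/-- The left-edge limit: `μ([0,x] × ·) / x` converges weakly to `μ₀` as `x → 0+`. -/
def HasLeftEdgeLimit (μ : Measure (ℝ × ℝ)) (μ₀ : Measure ℝ) : Prop :=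
  WeaklyConverges (leftEdgeMeasure μ) (𝓝[>] 0) μ₀

/-- The constant in the density of `μ⁽¹⁾`; the factor `2` is what makes the second marginal
uniform. -/
noncomputable def permutonC : ℝ := 2 * ∫ x in (0 : ℝ)..(1 / 2), Real.sin (Real.log x)

open Classical in
/-- The density of `μ⁽¹⁾`. -/
noncomputable def permutonDensity1 (p : ℝ × ℝ) : ℝ :=
  if p ∈ Set.Ioo (0 : ℝ) (1 / 2) ×ˢ Set.Ioo (0 : ℝ) (1 / 2) then 1 + Real.sin (Real.log p.1)
  else if p ∈ Set.Ioo (0 : ℝ) (1 / 2) ×ˢ Set.Ioo (1 / 2 : ℝ) 1 then 1 - Real.sin (Real.log p.1)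
  else if p ∈ Set.Ioo (1 / 2 : ℝ) 1 ×ˢ Set.Ioo (0 : ℝ) (1 / 2) then 1 - permutonC
  else if p ∈ Set.Ioo (1 / 2 : ℝ) 1 ×ˢ Set.Ioo (1 / 2 : ℝ) 1 then 1 + permutonC
  else 0

/-- The permuton `μ⁽¹⁾`. -/
noncomputable def permuton1 : Measure (ℝ × ℝ) :=
  volume.withDensity fun p => ENNReal.ofReal (permutonDensity1 p)

/-- The affine map of the unit square onto its lower right quarter. -/
noncomputable def toLowerRight (p : ℝ × ℝ) : ℝ × ℝ := ((p.1 + 1) / 2, p.2 / 2)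

/-- The permuton `μ⁽²⁾`: mass `1/2` spread uniformly on the segment from `(0,1/2)` to `(1/2,1)`,
and a copy of `μ⁽¹⁾` of mass `1/2` in the lower right quarter. -/
noncomputable def permuton2 : Measure (ℝ × ℝ) :=
  (volume.restrict (Set.Icc (0 : ℝ) (1 / 2))).map (fun t : ℝ => (t, 1 / 2 + t))
    + (1 / 2 : ℝ≥0∞) • permuton1.map toLowerRight

/-! ### An oscillating sequence of integrals -/

/-! Non-convergence is detected by the single number `E t(T_n, 00)`. Since `t(T_n, 00)` lies in `[0,
1]`, convergence in distribution would force these expectations to converge.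

Except with probability `2^(-n)`, some point falls in the left half. The root is then the leftmost
point of the increasing segment; every other point of the segment is above it and every point of the
lower right quarter is below it. The left subtree of the root is therefore the search tree of the
points of the right half. Its own root is the leftmost of these points, and the nodes below `00` are
the points to the lower right of it (`card_leftmostPairs`).

Hence, for `n = m + 2` and up to an exponentially small error, `E t(T_n, 00)` is `m + 1` times the
probability that a given pair consists of this leftmost point `p` and a point to its lower right.
Conditioning on `p = (x, y)` turns this into an integral of `(3/2 - x)^m` times the mass to the
lower right of `p`. Replacing that mass by `y` costs only `O(1/m)` in the expectation
(`abs_leftmostPairProb_sub_le`).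

In the coordinates of `μ⁽¹⁾` the mean ordinate at abscissa `x` is `1/2 - densityDev x / 4`.
Everything thus reduces to `(m + 1) ∫ (1 - x/2)^m densityDev x dx`, which looks at `sin (log x)` at
scale `1/m`. A Beta integral gives `Im (c m^(-i))` asymptotically, with `c` a nonzero multiple of
`2^i Γ(1 + i)`: this oscillates forever, with period `2π` in `log m`.

The marginals are uniform because the density of `μ⁽¹⁾` is `1 + densityDev x * heightSign y` with
both factors of mean zero. The left-edge limit exists because near the left edge `μ⁽²⁾` sees only
the segment. -/

theorem not_tendsto_im_mul_natCast_cpow {γ : ℕ → ℂ} {c : ℂ} (hc : c ≠ 0)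
    (hγ : Tendsto γ atTop (𝓝 c)) (L : ℝ) :
    ¬ Tendsto (fun m : ℕ => (γ m * (m : ℂ) ^ (-Complex.I)).im) atTop (𝓝 L) := by
  intro h
  have key : ∀ φ : ℝ, (c * Complex.exp (-(φ * Complex.I))).im = L := by
    intro φ
    -- Along the integer parts of `exp (2πk + φ)`, the power `m^(-i)` tends to `exp (-iφ)`, because
    -- rounding changes `log m` by `o(1)`. Every phase `φ` is thus attained in the limit.
    let E : ℕ → ℝ := fun k => Real.exp (k * (2 * Real.pi) + φ)
    have hlin : Tendsto (fun k : ℕ => (k : ℝ) * (2 * Real.pi) + φ) atTop atTop :=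
      tendsto_atTop_add_const_right _ _
        (tendsto_natCast_atTop_atTop.atTop_mul_const Real.two_pi_pos)
    have hE : Tendsto E atTop atTop := Real.tendsto_exp_atTop.comp hlin
    have hM : Tendsto (fun k => ⌊E k⌋₊) atTop atTop := tendsto_nat_floor_atTop.comp hE
    have hratio : Tendsto (fun k => (⌊E k⌋₊ : ℝ) / E k) atTop (𝓝 1) :=
      (tendsto_nat_floor_div_atTop (R := ℝ)).comp hE
    have hlog : Tendsto (fun k => Real.log ((⌊E k⌋₊ : ℝ) / E k)) atTop (𝓝 0) := by
      simpa using hratio.log one_ne_zero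
    have hpow : Tendsto (fun k => ((⌊E k⌋₊ : ℕ) : ℂ) ^ (-Complex.I)) atTop
        (𝓝 (Complex.exp (-(φ * Complex.I)))) := by
      have h1 : Tendsto (fun k => Complex.exp
          (-((Real.log ((⌊E k⌋₊ : ℝ) / E k) + φ : ℝ) * Complex.I))) atTop
          (𝓝 (Complex.exp (-((0 + φ : ℝ) * Complex.I)))) := by
        have hcont : Continuous fun x : ℝ => Complex.exp (-((x : ℝ) * Complex.I)) := by fun_prop
        exact (hcont.tendsto _).comp (hlog.add_const φ)
      rw [zero_add] at h1
      refine h1.congr' ?_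
      filter_upwards [hM.eventually_ge_atTop 1] with k hk
      have hpos : (0 : ℝ) < (⌊E k⌋₊ : ℝ) := by exact_mod_cast hk
      rw [Complex.cpow_def_of_ne_zero (by exact_mod_cast hpos.ne'),
        Real.log_div hpos.ne' (Real.exp_pos _).ne', Real.log_exp, ← Complex.natCast_log]
      -- The two real phases differ by exactly `2πk`.
      rw [Complex.exp_eq_exp_iff_exists_int]
      refine ⟨k, ?_⟩
      push_cast
      ring
    have h2 := (Complex.continuous_im.tendsto _).comp ((hγ.comp hM).mul hpow)
    exact tendsto_nhds_unique h2 (h.comp hM)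
  -- The phases `0` and `π` give `Im c = L = -Im c`, and `π / 2` gives `-Re c = L`; together they
  -- force `c = 0`.
  have h0 := key 0
  have h1 := key Real.pi
  have h2 := key (Real.pi / 2)
  have e1 : Complex.exp (-((Real.pi : ℝ) * Complex.I)) = -1 := by
    rw [Complex.exp_neg, Complex.exp_pi_mul_I]; norm_num
  have e2 : Complex.exp (-((Real.pi / 2 : ℝ) * Complex.I)) = -Complex.I := by
    rw [Complex.exp_neg, Complex.ofReal_div, Complex.ofReal_ofNat, Complex.exp_pi_div_two_mul_I,
      Complex.inv_I]
  rw [e1] at h1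
  rw [e2] at h2
  simp at h0 h1 h2
  exact hc (Complex.ext (by simp; linarith) (by simp; linarith))

theorem ofReal_cpow_I_im {x : ℝ} (hx : 0 < x) : ((x : ℂ) ^ Complex.I).im = Real.sin (Real.log x) := by
  rw [Complex.cpow_def_of_ne_zero (by exact_mod_cast hx.ne'), ← Complex.ofReal_log hx.le,
    Complex.exp_ofReal_mul_I_im]

/-- Since `sin (log (2u))` is the imaginary part of `(2u)^i`, the integral is the imaginary part of
`2^i B(1 + i, m + 1)`. Writing the Beta value through `GammaSeq` isolates the oscillating factor
`m^(-i)` from one with a known limit. -/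
theorem integral_one_sub_pow_mul_sin_log {m : ℕ} (hm : m ≠ 0) :
    ∫ u in (0 : ℝ)..1, (1 - u) ^ m * Real.sin (Real.log (2 * u)) =
      ((2 : ℂ) ^ Complex.I * Complex.GammaSeq (1 + Complex.I) m / m * (m : ℂ) ^ (-Complex.I)).im := by
  have hre : 0 < (1 + Complex.I).re := by simp
  have hm' : (m : ℂ) ≠ 0 := by exact_mod_cast hm
  have hB := Complex.GammaSeq_eq_betaIntegral_of_re_pos hre m
  have e : (2 : ℂ) ^ Complex.I * Complex.GammaSeq (1 + Complex.I) m / m * (m : ℂ) ^ (-Complex.I)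
      = (2 : ℂ) ^ Complex.I * Complex.betaIntegral (1 + Complex.I) (m + 1) := by
    rw [hB, Complex.cpow_add _ _ hm', Complex.cpow_one, Complex.cpow_neg]
    have : (m : ℂ) ^ Complex.I ≠ 0 := by simp [Complex.cpow_eq_zero_iff, hm']
    field_simp
  rw [e, Complex.betaIntegral, ← intervalIntegral.integral_const_mul]
  have hint : IntervalIntegrable (fun x : ℝ => (2 : ℂ) ^ Complex.I *
      ((x : ℂ) ^ (1 + Complex.I - 1) * (1 - (x : ℂ)) ^ ((m : ℂ) + 1 - 1))) volume 0 1 :=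
    (Complex.betaIntegral_convergent hre (by simp; positivity)).const_mul _
  rw [intervalIntegral.integral_of_le zero_le_one] at *
  rw [intervalIntegral.integral_of_le zero_le_one]
  have := integral_im (𝕜 := ℂ) (intervalIntegrable_iff_integrableOn_Ioc_of_le zero_le_one |>.1 hint)
  simp only [RCLike.im_to_complex] at this
  rw [← this]
  refine setIntegral_congr_fun measurableSet_Ioc fun x hx => ?_
  simp only [add_sub_cancel_left, add_sub_cancel_right, Complex.cpow_natCast]
  have h2 : (2 : ℂ) ^ Complex.I * ((x : ℂ) ^ Complex.I * (1 - (x : ℂ)) ^ m)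
      = (((1 - x) ^ m : ℝ) : ℂ) * ((2 * x : ℝ) : ℂ) ^ Complex.I := by
    have := Complex.mul_cpow_ofReal_nonneg (a := 2) (b := x) (by norm_num) hx.1.le Complex.I
    push_cast at this ⊢
    rw [this]; ring
  rw [h2, Complex.im_ofReal_mul, ofReal_cpow_I_im (by linarith [hx.1])]

/-- Only the behaviour of `s` near `0` matters, because `(1 - x/2)^m` is exponentially small away
from `0`. So `s` may be replaced by `sin (log x)` and the Beta integral applies. -/
theorem not_tendsto_integral_one_sub_half_pow {s : ℝ → ℝ} (hmeas : Measurable s)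
    (hbd : ∀ x, |s x| ≤ 1) (hs : ∀ x ∈ Set.Ioo (0 : ℝ) (1 / 2), s x = Real.sin (Real.log x))
    (L : ℝ) :
    ¬ Tendsto (fun m : ℕ => ((m : ℝ) + 1) * ∫ x in (0 : ℝ)..1, (1 - x / 2) ^ m * s x) atTop
      (𝓝 L) := by
  intro h
  -- Error of the replacement after substituting `x = 2u`. It vanishes for `u < 1/4`, and beyond
  -- that `(1 - u)^m ≤ (3/4)^m`.
  let r : ℝ → ℝ := fun u =>
    (if u ≤ 1 / 2 then s (u * 2) else 0) - Real.sin (Real.log (2 * u))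
  have hrm : Measurable r := by
    refine Measurable.sub (Measurable.ite (measurableSet_le measurable_id measurable_const)
      (hmeas.comp (by fun_prop)) measurable_const) (by fun_prop)
  have hrb : ∀ u, |r u| ≤ 2 := by
    intro u
    have h1 := abs_le.1 (Real.abs_sin_le_one (Real.log (2 * u)))
    have h2 := abs_le.1 (hbd (u * 2))
    rw [abs_le]
    simp only [r]
    split_ifs <;> constructor <;> linarith
  have hi : ∀ (m : ℕ) (g : ℝ → ℝ) (a b : ℝ), Measurable g → (∀ x, |g x| ≤ 2) →
      IntervalIntegrable (fun u => (1 - u) ^ m * g u) volume a b := by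
    intro m g a b hg hgb
    have : IntervalIntegrable g volume a b :=
      (intervalIntegrable_const (c := (2 : ℝ))).mono_fun' hg.aestronglyMeasurable (ae_of_all _ hgb)
    exact this.continuousOn_mul (by fun_prop)
  have hsb : ∀ x, |(fun u => Real.sin (Real.log (2 * u))) x| ≤ 2 := fun x =>
    (Real.abs_sin_le_one _).trans (by norm_num)
  have heq : ∀ m : ℕ, (∫ x in (0 : ℝ)..1, (1 - x / 2) ^ m * s x) / 2
      - (∫ u in (0 : ℝ)..1, (1 - u) ^ m * Real.sin (Real.log (2 * u)))
      = ∫ u in (0 : ℝ)..1, (1 - u) ^ m * r u := by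
    intro m
    have h1 : (∫ x in (0 : ℝ)..1, (1 - x / 2) ^ m * s x) / 2
        = ∫ u in (0 : ℝ)..(1 / 2), (1 - u) ^ m * s (u * 2) := by
      have := intervalIntegral.integral_comp_mul_right (a := 0) (b := 1 / 2)
        (fun x => (1 - x / 2) ^ m * s x) (c := 2) (by norm_num)
      norm_num at this
      rw [this]; ring
    have h2 : ∫ u in (0 : ℝ)..(1 / 2), (1 - u) ^ m * s (u * 2)
        = ∫ u in (0 : ℝ)..1, (1 - u) ^ m * (if u ≤ 1 / 2 then s (u * 2) else 0) := by
      rw [intervalIntegral.integral_of_le (by norm_num), intervalIntegral.integral_of_le (by norm_num),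
        ← integral_indicator measurableSet_Ioc, ← integral_indicator measurableSet_Ioc]
      congr 1
      ext u
      by_cases hu : u ≤ 1 / 2
      · have : u ≤ 1 := by linarith
        simp only [Set.indicator, Set.mem_Ioc, hu, this, and_true, if_true]
      · simp only [Set.indicator, Set.mem_Ioc, hu, and_false, if_false, mul_zero, ite_self]
    rw [h1, h2, ← intervalIntegral.integral_sub]
    · simp only [r, mul_sub]
    · refine hi m _ _ _ (Measurable.ite (measurableSet_le measurable_id measurable_const)
        (hmeas.comp (by fun_prop)) measurable_const) fun x => ?_
      split_ifs
      · exact (hbd _).trans (by norm_num)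
      · simp
    · exact hi m _ _ _ (by fun_prop) hsb
  have hsmall : ∀ m : ℕ, |∫ u in (0 : ℝ)..1, (1 - u) ^ m * r u| ≤ (3 / 4) ^ m * 2 := by
    intro m
    have := intervalIntegral.norm_integral_le_of_norm_le_const_ae (a := 0) (b := 1)
      (f := fun u => (1 - u) ^ m * r u) (C := (3 / 4) ^ m * 2) ?_
    · simpa using this
    · refine ae_of_all _ fun u hu => ?_
      rw [Set.uIoc_of_le zero_le_one] at hu
      rcases lt_or_ge u (1 / 4) with h4 | h4
      · have : r u = 0 := by
          simp only [r]
          rw [if_pos (by linarith), hs _ ⟨by linarith [hu.1], by linarith⟩, mul_comm, sub_self]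
        rw [this, mul_zero, norm_zero]; positivity
      · rw [norm_mul, norm_pow, Real.norm_eq_abs, Real.norm_eq_abs,
          abs_of_nonneg (by linarith [hu.2])]
        gcongr
        · linarith [hu.2]
        · linarith
        · exact hrb u
  have hto0 : Tendsto (fun m : ℕ => ((m : ℝ) + 1) * ∫ u in (0 : ℝ)..1, (1 - u) ^ m * r u) atTop
      (𝓝 0) := by
    have hb : Tendsto (fun m : ℕ => 2 * ((m : ℝ) * (3 / 4 : ℝ) ^ m + (3 / 4 : ℝ) ^ m)) atTop
        (𝓝 (2 * (0 + 0))) :=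
      ((tendsto_self_mul_const_pow_of_lt_one (by norm_num) (by norm_num)).add
        (tendsto_pow_atTop_nhds_zero_of_lt_one (by norm_num) (by norm_num))).const_mul 2
    rw [add_zero, mul_zero] at hb
    refine squeeze_zero_norm (fun m => ?_) hb
    rw [norm_mul, Real.norm_eq_abs, Real.norm_eq_abs, abs_of_nonneg (by positivity)]
    calc _ ≤ ((m : ℝ) + 1) * ((3 / 4) ^ m * 2) := by gcongr; exact hsmall m
      _ = _ := by ring
  have hlim : Tendsto (fun m : ℕ => ((m : ℝ) + 1) *
      ∫ u in (0 : ℝ)..1, (1 - u) ^ m * Real.sin (Real.log (2 * u))) atTop (𝓝 (L / 2 - 0)) := by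
    refine ((h.div_const 2).sub hto0).congr fun m => ?_
    rw [← heq m]; ring
  -- What remains of `(m + 1) 2^i B(1 + i, m + 1)` once `m^(-i)` is factored out. Its limit `2^i Γ(1
  -- + i)` is nonzero because `Γ` has no zero with positive real part.
  let γ : ℕ → ℂ := fun m => (((m : ℝ) + 1) / m : ℝ) *
    ((2 : ℂ) ^ Complex.I * Complex.GammaSeq (1 + Complex.I) m)
  have hγ : Tendsto γ atTop (𝓝 ((1 : ℝ) * ((2 : ℂ) ^ Complex.I * Complex.Gamma (1 + Complex.I)))) := by
    refine Tendsto.mul ?_ ((Complex.GammaSeq_tendsto_Gamma _).const_mul _)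
    refine (Complex.continuous_ofReal.tendsto _).comp ?_
    have : Tendsto (fun m : ℕ => 1 + 1 / (m : ℝ)) atTop (𝓝 (1 + 0)) :=
      tendsto_one_div_atTop_nhds_zero_nat.const_add 1
    rw [add_zero] at this
    refine this.congr' ?_
    filter_upwards [eventually_ge_atTop 1] with m hm
    have : (m : ℝ) ≠ 0 := by positivity
    field_simp
  have hne : ((1 : ℝ) * ((2 : ℂ) ^ Complex.I * Complex.Gamma (1 + Complex.I))) ≠ 0 := by
    have h2 : (2 : ℂ) ^ Complex.I ≠ 0 := by simp [Complex.cpow_eq_zero_iff]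
    have := Complex.Gamma_ne_zero_of_re_pos (s := 1 + Complex.I) (by simp)
    simp [h2, this]
  refine not_tendsto_im_mul_natCast_cpow hne hγ _ (hlim.congr' ?_)
  filter_upwards [eventually_ge_atTop 1] with m hm
  rw [integral_one_sub_pow_mul_sin_log (by omega)]
  simp only [γ]
  rw [← Complex.im_ofReal_mul]
  congr 1
  push_cast
  ring

/-! ### The left spine of a binary search tree -/

/-- The label at the root never changes, so later entries split into two subsequences that evolve
independently in the two subtrees. -/
theorem foldl_bstInsert_node (a : ℝ) (ys : List ℝ) (l r : BinaryTree ℝ) :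
    ys.foldl (fun T y => bstInsert y T) (.node a l r) =
      .node a ((ys.filter (· < a)).foldl (fun T y => bstInsert y T) l)
        ((ys.filter (¬ · < a)).foldl (fun T y => bstInsert y T) r) := by
  induction ys generalizing l r with
  | nil => rfl
  | cons y ys ih =>
    by_cases h : y < a
    · simp [bstInsert, h, ih]
    · simp [bstInsert, h, ih, not_lt.1 h]

theorem bst_cons (a : ℝ) (ys : List ℝ) :
    bst (a :: ys) = .node a (bst (ys.filter (· < a))) (bst (ys.filter (¬ · < a))) :=
  foldl_bstInsert_node a ys .nil .nil

theorem card_treeNodes {α : Type*} (T : BinaryTree α) : (treeNodes T).card = T.numNodes := by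
  induction T with
  | nil => rfl
  | node a l r hl hr =>
    rw [treeNodes, Finset.card_insert_of_notMem (by simp), Finset.card_union_of_disjoint,
      Finset.card_image_of_injective _ List.cons_injective,
      Finset.card_image_of_injective _ List.cons_injective, hl, hr, BinaryTree.numNodes]
    simp [Finset.disjoint_left]

theorem numNodes_bstInsert (x : ℝ) (T : BinaryTree ℝ) :
    (bstInsert x T).numNodes = T.numNodes + 1 := by
  induction T with
  | nil => rfl
  | node a l r hl hr =>
    rw [bstInsert]
    split_ifs
    · simp [hl]; omega
    · simp [hr]; omega

theorem numNodes_bst (ys : List ℝ) : (bst ys).numNodes = ys.length := by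
  induction ys using List.reverseRecOn with
  | nil => rfl
  | append_singleton l y ih =>
    rw [show bst (l ++ [y]) = bstInsert y (bst l) by simp [bst], numNodes_bstInsert, ih]
    simp

theorem card_filter_prefix_node {α : Type*} (a : α) (l r : BinaryTree α) (v : List Bool) :
    ((treeNodes (.node a l r)).filter (fun u => false :: v <+: u)).card =
      ((treeNodes l).filter (fun u => v <+: u)).card := by
  rw [← Finset.card_image_of_injective (s := (treeNodes l).filter (fun u => v <+: u))
    (f := List.cons false) List.cons_injective]
  congr 1
  ext u
  simp only [treeNodes, Finset.mem_filter, Finset.mem_insert, Finset.mem_union, Finset.mem_image]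
  constructor
  · rintro ⟨rfl | ⟨w, hw, rfl⟩ | ⟨w, hw, rfl⟩, h⟩
    · simp at h
    · exact ⟨w, ⟨hw, by simpa using h⟩, rfl⟩
    · simp at h
  · rintro ⟨w, ⟨hw, h⟩, rfl⟩
    exact ⟨Or.inr (Or.inl ⟨w, hw, rfl⟩), by simpa using h⟩

/-- The left child of the root `a` carries `b`, the first later entry below `a`; among the entries
sent left, exactly those below `b` go further left. -/
theorem card_filter_left_left (a b : ℝ) (ys zs : List ℝ) (h : ys.filter (· < a) = b :: zs) :
    ((treeNodes (bst (a :: ys))).filter (fun u => [false, false] <+: u)).card =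
      (zs.filter (· < b)).length := by
  rw [bst_cons, card_filter_prefix_node, h, bst_cons, card_filter_prefix_node]
  simp [card_treeNodes, numNodes_bst]

theorem card_filter_left_left_nil (a : ℝ) (ys : List ℝ) (h : ys.filter (· < a) = []) :
    ((treeNodes (bst (a :: ys))).filter (fun u => [false, false] <+: u)).card = 0 := by
  rw [bst_cons, card_filter_prefix_node, h]
  simp [bst, treeNodes]

theorem subtreeProportion_mem_Icc {α : Type*} (T : BinaryTree α) (v : List Bool) :
    subtreeProportion T v ∈ Set.Icc (0 : ℝ) 1 := by
  refine ⟨by unfold subtreeProportion; positivity, div_le_one_of_le₀ ?_ (by positivity)⟩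
  exact_mod_cast Finset.card_filter_le _ _

/-- A point lies on the segment from `(0, 1/2)` to `(1/2, 1)` or in the lower right quarter. -/
def IsSupported (p : ℝ × ℝ) : Prop :=
  (0 < p.1 ∧ p.1 < 1 / 2 ∧ p.2 = 1 / 2 + p.1) ∨ (1 / 2 < p.1 ∧ p.1 < 1 ∧ 0 < p.2 ∧ p.2 < 1 / 2)

/-- `i` is the leftmost point of the right half, and `j` is to its lower right. -/
def IsLeftmostPair {n : ℕ} (ω : Fin n → ℝ × ℝ) (i j : Fin n) : Prop :=
  1 / 2 < (ω i).1 ∧ (ω i).1 < (ω j).1 ∧ (ω j).2 < (ω i).2 ∧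
    ∀ k, k ≠ i → k ≠ j → (ω k).1 ∉ Set.Ioo (1 / 2) (ω i).1

/-- The segment is increasing and lies above height `1/2`. The points after `p` on the segment are
therefore higher than `p`, and all points of the lower right quarter are lower. -/
theorem filter_of_sorted_supported {p : ℝ × ℝ} {l : List (ℝ × ℝ)}
    (hs : ∀ q ∈ p :: l, IsSupported q) (hl : (p :: l).Pairwise (fun a b => a.1 < b.1))
    (hp : p.1 < 1 / 2) :
    (l.map Prod.snd).filter (· < p.2) = ((p :: l).filter (1 / 2 < ·.1)).map Prod.snd := by
  rw [List.filter_cons_of_neg (by simpa using hp.le), List.filter_map]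
  congr 1
  refine List.filter_congr fun q hq => ?_
  have h1 := (List.pairwise_cons.1 hl).1 q hq
  have h2 := hs q (List.mem_cons_of_mem _ hq)
  have h3 := hs p List.mem_cons_self
  simp only [Function.comp_apply, decide_eq_decide]
  unfold IsSupported at h2 h3
  constructor
  · intro h
    rcases h2 with h2 | h2 <;> rcases h3 with h3 | h3 <;> linarith [h2.1, h2.2.1, h3.1, h3.2.1, h3.2.2, h2.2.2]
  · intro h
    rcases h2 with h2 | h2
    · linarith [h2.2.1]
    · rcases h3 with h3 | h3
      · linarith [h2.2.2.2, h3.2.2, h3.1]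
      · linarith [h3.1]

open Classical in
-- Counting by pairs makes the size of the subtree at `00` a sum of indicators, whose expectation
-- can be computed term by term.
theorem card_leftmostPairs {n : ℕ} (ω : Fin n → ℝ × ℝ) (hs : ∀ i, IsSupported (ω i))
    (hinj : Function.Injective fun i => (ω i).1) (hex : ∃ i, (ω i).1 < 1 / 2) :
    ((treeNodes (bstOfPoints ω)).filter (fun u => [false, false] <+: u)).card =
      ∑ i, ∑ j, if IsLeftmostPair ω i j then 1 else 0 := by
  set σ := Tuple.sort (fun j => (ω j).1) with hσ
  set l : List (ℝ × ℝ) := List.ofFn (fun i => ω (σ i)) with hldef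
  have hbst : bstOfPoints ω = bst (l.map Prod.snd) := by
    rw [bstOfPoints, sortedOrdinates, hldef, List.map_ofFn]; rfl
  have hmono : StrictMono fun i => (ω (σ i)).1 :=
    (Tuple.monotone_sort (fun j => (ω j).1)).strictMono_of_injective (hinj.comp σ.injective)
  have hpw : l.Pairwise (fun a b => a.1 < b.1) := by
    rw [hldef, List.pairwise_ofFn]
    exact fun i j hij => hmono hij
  have hmem : ∀ q, q ∈ l ↔ ∃ i, ω i = q := by
    intro q
    rw [hldef, List.mem_ofFn]
    exact ⟨fun ⟨i, h⟩ => ⟨σ i, h⟩, fun ⟨i, h⟩ => ⟨σ.symm i, by simpa using h⟩⟩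
  have hsl : ∀ q ∈ l, IsSupported q := fun q hq => by
    obtain ⟨i, rfl⟩ := (hmem q).1 hq
    exact hs i
  have hcount : ∀ (P : ℝ × ℝ → Prop) [DecidablePred P],
      (l.filter (fun q => decide (P q))).length =
      ∑ j, if P (ω j) then 1 else 0 := by
    intro P _
    rw [Finset.sum_boole, ← List.countP_eq_length_filter, hldef, Nat.cast_id]
    have : List.ofFn (fun i => ω (σ i)) = (List.ofFn σ).map ω := by rw [List.map_ofFn]; rfl
    rw [this, List.countP_map, List.countP_eq_length_filter]
    rw [← List.toFinset_card_of_nodup ((List.nodup_ofFn.2 σ.injective).filter _)]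
    congr 1
    ext j
    simp [List.mem_ofFn]
    exact fun _ => ⟨σ.symm j, by simp⟩
  obtain ⟨i₀, hi₀⟩ := hex
  match l, hpw, hmem, hsl, hcount, hbst with
  | [], _, hmem, _, _, _ => exact absurd ((hmem (ω i₀)).2 ⟨i₀, rfl⟩) (by simp)
  | p :: l, hpw, hmem, hsl, hcount, hbst =>
    have hp : p.1 < 1 / 2 := by
      rcases List.mem_cons.1 ((hmem (ω i₀)).2 ⟨i₀, rfl⟩) with h | h
      · rwa [← h]
      · exact ((List.pairwise_cons.1 hpw).1 _ h).trans hi₀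
    have hf := filter_of_sorted_supported hsl hpw hp
    rw [hbst, List.map_cons]
    rcases hR : (p :: l).filter (1 / 2 < ·.1) with _ | ⟨q, w⟩
    · rw [hR, List.map_nil] at hf
      rw [card_filter_left_left_nil _ _ hf]
      symm
      refine Finset.sum_eq_zero fun i _ => Finset.sum_eq_zero fun j _ => if_neg fun h => ?_
      have : ω i ∈ (p :: l).filter (1 / 2 < ·.1) :=
        List.mem_filter.2 ⟨(hmem _).2 ⟨i, rfl⟩, by simpa using h.1⟩
      rw [hR] at this
      simp at this
    · rw [hR, List.map_cons] at hf
      rw [card_filter_left_left _ _ _ _ hf]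
      have hq : q ∈ (p :: l).filter (1 / 2 < ·.1) := by rw [hR]; exact List.mem_cons_self
      rw [List.mem_filter, decide_eq_true_eq] at hq
      obtain ⟨i, rfl⟩ := (hmem q).1 hq.1
      have hpw' := hpw.filter (fun q : ℝ × ℝ => decide (1 / 2 < q.1))
      rw [hR, List.pairwise_cons] at hpw'
      have hmin : ∀ j, 1 / 2 < (ω j).1 → j ≠ i → (ω i).1 < (ω j).1 := by
        intro j hj hji
        have : ω j ∈ (p :: l).filter (1 / 2 < ·.1) :=
          List.mem_filter.2 ⟨(hmem _).2 ⟨j, rfl⟩, by simpa using hj⟩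
        rw [hR, List.mem_cons] at this
        rcases this with h | h
        · exact absurd (hinj (congrArg Prod.fst h)) hji
        · exact hpw'.1 _ h
      have h1 : ((w.map Prod.snd).filter (· < (ω i).2)).length =
          ((p :: l).filter (fun q => decide (1 / 2 < q.1 ∧ q.2 < (ω i).2))).length := by
        have : ((p :: l).filter (fun q => decide (1 / 2 < q.1 ∧ q.2 < (ω i).2))) =
            ((p :: l).filter (1 / 2 < ·.1)).filter (·.2 < (ω i).2) := by
          rw [List.filter_filter]
          refine List.filter_congr fun q _ => ?_
          simp [and_comm]
        rw [this, hR, List.filter_cons_of_neg (by simp), List.filter_map, List.length_map]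
        rfl
      rw [h1, hcount (fun q => 1 / 2 < q.1 ∧ q.2 < (ω i).2)]
      symm
      -- Only the leftmost index `i` of the right half contributes. For another `i'`, the point `i`
      -- either is the partner `j`, which should lie to the right of `i'`, or is a third point in
      -- the forbidden strip.
      rw [Finset.sum_eq_single i]
      · refine Finset.sum_congr rfl fun j _ => if_congr ?_ rfl rfl
        symm
        constructor
        · rintro ⟨h1, h2⟩
          refine ⟨hq.2, hmin j h1 fun h => ?_, h2, fun k hki _ hk => ?_⟩
          · rw [h] at h2; exact lt_irrefl _ h2
          · exact lt_asymm hk.2 (hmin k hk.1 hki)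
        · rintro ⟨h1, h2, h3, -⟩
          exact ⟨h1.trans h2, h3⟩
      · intro i' _ hi'
        refine Finset.sum_eq_zero fun j _ => if_neg fun h => ?_
        have hlt := hmin i' h.1 hi'
        by_cases hj : i = j
        · subst hj
          exact lt_asymm hlt h.2.1
        · exact h.2.2.2 i (Ne.symm hi') hj ⟨hq.2, hlt⟩
      · simp

/-! ### The permutons -/

/-- The uniform measure on the unit interval. -/
noncomputable abbrev unifI : Measure ℝ := volume.restrict (Set.Icc 0 1)

instance : IsProbabilityMeasure unifI := ⟨by simp⟩

/-- The deviation of the density of `permuton1` from `1`, as a function of the abscissa. -/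
noncomputable def densityDev (x : ℝ) : ℝ :=
  if x < 1 / 2 then Real.sin (Real.log x) else -permutonC

/-- The sign of the deviation of the density, as a function of the ordinate. -/
noncomputable def heightSign (y : ℝ) : ℝ := if y < 1 / 2 then 1 else -1

theorem measurable_densityDev : Measurable densityDev :=
  Measurable.ite (measurableSet_lt measurable_id measurable_const) (by fun_prop) measurable_const

theorem measurable_heightSign : Measurable heightSign :=
  Measurable.ite (measurableSet_lt measurable_id measurable_const) measurable_const
    measurable_const

/-- The factor `2` is compensated by the length `1/2` of the interval. This keeps `1 ± C`
nonnegative. -/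
theorem abs_permutonC_le : |permutonC| ≤ 1 := by
  have := intervalIntegral.norm_integral_le_of_norm_le_const (a := 0) (b := 1 / 2) (C := 1)
    (f := fun x => Real.sin (Real.log x)) fun x _ => Real.abs_sin_le_one _
  rw [permutonC, abs_mul]
  norm_num at this ⊢
  linarith

theorem abs_densityDev_le (x : ℝ) : |densityDev x| ≤ 1 := by
  unfold densityDev
  split_ifs
  · exact Real.abs_sin_le_one _
  · rw [abs_neg]; exact abs_permutonC_le

theorem abs_heightSign (y : ℝ) : |heightSign y| = 1 := by
  unfold heightSign; split_ifs <;> simp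

theorem density_nonneg (x y : ℝ) : 0 ≤ 1 + densityDev x * heightSign y := by
  have : |densityDev x * heightSign y| ≤ 1 := by
    rw [abs_mul, abs_heightSign, mul_one]; exact abs_densityDev_le x
  linarith [(abs_le.1 this).1]

theorem density_le (x y : ℝ) : 1 + densityDev x * heightSign y ≤ 2 := by
  have : |densityDev x * heightSign y| ≤ 1 := by
    rw [abs_mul, abs_heightSign, mul_one]; exact abs_densityDev_le x
  linarith [(abs_le.1 this).2]

theorem measurable_density :
    Measurable fun p : ℝ × ℝ => 1 + densityDev p.1 * heightSign p.2 :=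
  ((measurable_densityDev.comp measurable_fst).mul
    (measurable_heightSign.comp measurable_snd)).const_add 1

/-- The four cases of the density agree with one product formula away from the null lines where a
coordinate is `0`, `1/2` or `1`. Marginals and moments then reduce to one-variable integrals. -/
theorem permuton1_eq :
    permuton1 = (unifI.prod unifI).withDensity fun p =>
      ENNReal.ofReal (1 + densityDev p.1 * heightSign p.2) := by
  rw [Measure.prod_restrict, ← Measure.volume_eq_prod,
    ← withDensity_indicator (measurableSet_Icc.prod measurableSet_Icc), permuton1]
  refine withDensity_congr_ae ?_
  have hne : ∀ c : ℝ, ∀ᵐ x : ℝ, x ≠ c := fun c => by simp [ae_iff]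
  have h1 : ∀ c : ℝ, ∀ᵐ p : ℝ × ℝ, p.1 ≠ c := fun c =>
    Measure.quasiMeasurePreserving_fst.ae (hne c)
  have h2 : ∀ c : ℝ, ∀ᵐ p : ℝ × ℝ, p.2 ≠ c := fun c =>
    Measure.quasiMeasurePreserving_snd.ae (hne c)
  filter_upwards [h1 0, h1 (1 / 2), h1 1, h2 0, h2 (1 / 2), h2 1] with p a1 a2 a3 b1 b2 b3
  by_cases hp : p ∈ Set.Icc (0 : ℝ) 1 ×ˢ Set.Icc (0 : ℝ) 1
  · rw [Set.indicator_of_mem hp]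
    obtain ⟨⟨hx0, hx1⟩, hy0, hy1⟩ := hp
    have hx0 := lt_of_le_of_ne hx0 a1.symm
    have hx1 := lt_of_le_of_ne hx1 a3
    have hy0 := lt_of_le_of_ne hy0 b1.symm
    have hy1 := lt_of_le_of_ne hy1 b3
    congr 1
    unfold permutonDensity1 densityDev heightSign
    simp only [Set.mem_prod, Set.mem_Ioo, hx0, hx1, hy0, hy1, true_and, and_true]
    rcases lt_or_gt_of_ne a2 with hx | hx <;> rcases lt_or_gt_of_ne b2 with hy | hy <;>
      simp only [hx, hy, hx.not_gt, hy.not_gt, if_true, if_false, and_true, and_false] <;>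
      ring
  · rw [Set.indicator_of_notMem hp, permutonDensity1, if_neg, if_neg, if_neg, if_neg]
    · simp
    all_goals
      contrapose! hp
      obtain ⟨⟨h1, h2⟩, h3, h4⟩ := hp
      exact ⟨⟨by linarith, by linarith⟩, by linarith, by linarith⟩

theorem integrable_unifI_of_abs_le {f : ℝ → ℝ} (hf : Measurable f) (C : ℝ)
    (h : ∀ x ∈ Set.Icc (0 : ℝ) 1, |f x| ≤ C) : Integrable f unifI :=
  Integrable.of_bound hf.aestronglyMeasurable C
    ((ae_restrict_iff' measurableSet_Icc).2 (ae_of_all _ h))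

theorem integral_unifI (f : ℝ → ℝ) : ∫ x, f x ∂unifI = ∫ x in (0 : ℝ)..1, f x := by
  rw [intervalIntegral.integral_of_le zero_le_one, integral_Icc_eq_integral_Ioc]

theorem integral_unifI_split {f : ℝ → ℝ} (hf : Integrable f unifI) :
    ∫ x, f x ∂unifI = (∫ x in (0 : ℝ)..(1 / 2), f x) + ∫ x in (1 / 2 : ℝ)..1, f x := by
  rw [integral_unifI, intervalIntegral.integral_add_adjacent_intervals]
  all_goals
    rw [intervalIntegrable_iff_integrableOn_Icc_of_le (by norm_num)]
    exact IntegrableOn.mono_set hf (Set.Icc_subset_Icc (by norm_num) (by norm_num))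

theorem intervalIntegral_left_congr {f g : ℝ → ℝ} (h : ∀ x < (1 / 2 : ℝ), f x = g x) :
    ∫ x in (0 : ℝ)..(1 / 2), f x = ∫ x in (0 : ℝ)..(1 / 2), g x := by
  rw [intervalIntegral.integral_of_le (by norm_num), intervalIntegral.integral_of_le (by norm_num),
    integral_Ioc_eq_integral_Ioo, integral_Ioc_eq_integral_Ioo]
  exact setIntegral_congr_fun measurableSet_Ioo fun x hx => h x hx.2

theorem intervalIntegral_right_congr {f g : ℝ → ℝ} (h : ∀ x > (1 / 2 : ℝ), f x = g x) :
    ∫ x in (1 / 2 : ℝ)..1, f x = ∫ x in (1 / 2 : ℝ)..1, g x := by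
  rw [intervalIntegral.integral_of_le (by norm_num), intervalIntegral.integral_of_le (by norm_num)]
  exact setIntegral_congr_fun measurableSet_Ioc fun x hx => h x hx.1

theorem integrable_densityDev : Integrable densityDev unifI :=
  integrable_unifI_of_abs_le measurable_densityDev 1 fun x _ => abs_densityDev_le x

theorem integrable_heightSign : Integrable heightSign unifI :=
  integrable_unifI_of_abs_le measurable_heightSign 1 fun x _ => (abs_heightSign x).le

/-- This is what fixes `C`: the left half contributes `C/2` and the right half `-C/2`. -/
theorem integral_densityDev : ∫ x, densityDev x ∂unifI = 0 := by
  rw [integral_unifI_split integrable_densityDev,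
    intervalIntegral_left_congr (f := densityDev)
      (g := fun x => Real.sin (Real.log x)) fun x hx => if_pos hx,
    intervalIntegral_right_congr (f := densityDev) (g := fun _ => -permutonC) fun x hx => if_neg (not_lt.2 hx.le)]
  simp only [permutonC, intervalIntegral.integral_const, smul_eq_mul]
  ring

theorem integral_heightSign : ∫ y, heightSign y ∂unifI = 0 := by
  rw [integral_unifI_split integrable_heightSign,
    intervalIntegral_left_congr (f := heightSign) (g := fun _ => 1) fun x hx => if_pos hx,
    intervalIntegral_right_congr (f := heightSign) (g := fun _ => -1) fun x hx => if_neg (not_lt.2 hx.le)]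
  simp only [intervalIntegral.integral_const, smul_eq_mul]
  ring

theorem integrable_mul_heightSign : Integrable (fun y => y * heightSign y) unifI := by
  refine integrable_unifI_of_abs_le (measurable_id.mul measurable_heightSign) 1 fun x hx => ?_
  rw [abs_mul, abs_heightSign, mul_one, abs_of_nonneg hx.1]
  exact hx.2

/-- The value is `1/8 - 3/8`. Being nonzero, it lets the oscillation of the density reach the mean
ordinate. -/
theorem integral_mul_heightSign : ∫ y, y * heightSign y ∂unifI = -(1 / 4) := by
  rw [integral_unifI_split integrable_mul_heightSign,
    intervalIntegral_left_congr (g := fun y => y) fun x hx => by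
      simp only [heightSign, if_pos hx, mul_one],
    intervalIntegral_right_congr (g := fun y => -y) fun x hx => by
      simp only [heightSign, if_neg (not_lt.2 (le_of_lt hx))]; ring]
  rw [intervalIntegral.integral_neg, integral_id, integral_id]
  norm_num

/-! ### Marginals of the two permutons -/

theorem lintegral_permuton1 {g : ℝ × ℝ → ℝ≥0∞} (hg : Measurable g) :
    ∫⁻ p, g p ∂permuton1 = ∫⁻ p, ENNReal.ofReal (1 + densityDev p.1 * heightSign p.2) * g p
      ∂(unifI.prod unifI) := by
  rw [permuton1_eq, lintegral_withDensity_eq_lintegral_mul _ measurable_density.ennreal_ofReal hg]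
  rfl

theorem permuton1_map_fst : permuton1.map Prod.fst = unifI := by
  refine Measure.ext_of_lintegral _ fun g hg => ?_
  rw [lintegral_map hg measurable_fst, lintegral_permuton1 (g := fun p => g p.1) (hg.comp measurable_fst),
    lintegral_prod (fun p : ℝ × ℝ => ENNReal.ofReal (1 + densityDev p.1 * heightSign p.2) * g p.1)
      (measurable_density.ennreal_ofReal.mul (hg.comp measurable_fst)).aemeasurable]
  refine lintegral_congr fun x => ?_
  dsimp only
  rw [lintegral_mul_const _ (measurable_heightSign.const_mul _ |>.const_add _).ennreal_ofReal,
    ← ofReal_integral_eq_lintegral_ofReal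
      (f := fun y => 1 + densityDev x * heightSign y) ((integrable_const _).add
      (integrable_heightSign.const_mul _)) (ae_of_all _ fun y => density_nonneg x y),
    integral_add (integrable_const _) (integrable_heightSign.const_mul _), integral_const_mul,
    integral_heightSign]
  simp

theorem permuton1_map_snd : permuton1.map Prod.snd = unifI := by
  refine Measure.ext_of_lintegral _ fun g hg => ?_
  rw [lintegral_map hg measurable_snd, lintegral_permuton1 (g := fun p => g p.2) (hg.comp measurable_snd),
    lintegral_prod_symm
      (fun p : ℝ × ℝ => ENNReal.ofReal (1 + densityDev p.1 * heightSign p.2) * g p.2)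
      (measurable_density.ennreal_ofReal.mul (hg.comp measurable_snd)).aemeasurable]
  refine lintegral_congr fun y => ?_
  dsimp only
  rw [lintegral_mul_const _ (measurable_densityDev.mul_const _ |>.const_add _).ennreal_ofReal,
    ← ofReal_integral_eq_lintegral_ofReal
      (f := fun x => 1 + densityDev x * heightSign y) ((integrable_const _).add
      (integrable_densityDev.mul_const _)) (ae_of_all _ fun x => density_nonneg x y),
    integral_add (integrable_const _) (integrable_densityDev.mul_const _), integral_mul_const,
    integral_densityDev]
  simp

theorem isPermuton_permuton1 : IsPermuton permuton1 := ⟨permuton1_map_fst, permuton1_map_snd⟩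

theorem IsPermuton.isProbabilityMeasure {μ : Measure (ℝ × ℝ)} (h : IsPermuton μ) :
    IsProbabilityMeasure μ := by
  constructor
  have := congrArg (fun ν => ν Set.univ) h.1
  rw [Measure.map_apply measurable_fst MeasurableSet.univ] at this
  simpa using this

instance : IsProbabilityMeasure permuton1 := isPermuton_permuton1.isProbabilityMeasure

theorem IsPermuton.ae_fst {μ : Measure (ℝ × ℝ)} (h : IsPermuton μ) {P : ℝ → Prop}
    (hP : ∀ᵐ x ∂unifI, P x) : ∀ᵐ p ∂μ, P p.1 :=
  ae_of_ae_map measurable_fst.aemeasurable (h.1 ▸ hP)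

theorem IsPermuton.ae_snd {μ : Measure (ℝ × ℝ)} (h : IsPermuton μ) {P : ℝ → Prop}
    (hP : ∀ᵐ x ∂unifI, P x) : ∀ᵐ p ∂μ, P p.2 :=
  ae_of_ae_map measurable_snd.aemeasurable (h.2 ▸ hP)

theorem ae_unifI_mem_Ioo : ∀ᵐ x ∂unifI, x ∈ Set.Ioo (0 : ℝ) 1 := by
  rw [unifI, ← restrict_Ioo_eq_restrict_Icc]
  exact ae_restrict_mem measurableSet_Ioo

theorem ae_unifI_ne (c : ℝ) : ∀ᵐ x ∂unifI, x ≠ c := ae_restrict_of_ae (by simp [ae_iff])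

theorem measurable_toLowerRight : Measurable toLowerRight := by
  unfold toLowerRight; fun_prop

theorem measurable_diagonal : Measurable fun t : ℝ => (t, 1 / 2 + t) := by fun_prop

/-- Halving lengths doubles the density, and the mass `1/2` restores it. The case `b = 1` serves the
abscissae of the lower right copy, `b = 0` its ordinates. -/
theorem half_smul_map_unifI (b : ℝ) :
    (1 / 2 : ℝ≥0∞) • unifI.map (fun x => (x + b) / 2) =
      volume.restrict (Set.Icc (b / 2) ((1 + b) / 2)) := by
  have h1 : (volume : Measure ℝ).map (fun x => (x + b) / 2) = (2 : ℝ≥0∞) • volume := by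
    have : (fun x : ℝ => (x + b) / 2) = (fun x => (2 : ℝ)⁻¹ * x) ∘ (fun x => x + b) := by
      ext x; simp; ring
    rw [this, ← Measure.map_map (by fun_prop) (by fun_prop), map_add_right_eq_self,
      Real.map_volume_mul_left (by norm_num)]
    simp
  have h2 : (fun x : ℝ => (x + b) / 2) ⁻¹' (Set.Icc (b / 2) ((1 + b) / 2)) = Set.Icc 0 1 := by
    ext x
    simp only [Set.mem_preimage, Set.mem_Icc]
    constructor <;> rintro ⟨h1, h2⟩ <;> constructor <;> linarith
  rw [unifI, ← h2, ← Measure.restrict_map (by fun_prop) measurableSet_Icc, h1,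
    Measure.restrict_smul, smul_smul, ENNReal.div_mul_cancel (by simp) (by simp), one_smul]

theorem restrict_Icc_add_half :
    (volume.restrict (Set.Icc (0 : ℝ) (1 / 2)) + volume.restrict (Set.Icc (1 / 2 : ℝ) 1)) = unifI := by
  rw [← restrict_Ico_eq_restrict_Icc, ← Measure.restrict_union _ measurableSet_Icc,
    Set.Ico_union_Icc_eq_Icc (by norm_num) (by norm_num)]
  rw [Set.disjoint_left]
  exact fun x h1 h2 => (h1.2.trans_le h2.1).false

theorem permuton2_map_fst : permuton2.map Prod.fst = unifI := by
  rw [permuton2, Measure.map_add _ _ measurable_fst, Measure.map_smul,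
    Measure.map_map measurable_fst measurable_diagonal,
    Measure.map_map measurable_fst measurable_toLowerRight,
    show Prod.fst ∘ toLowerRight = (fun x => (x + 1) / 2) ∘ Prod.fst from rfl,
    ← Measure.map_map (by fun_prop) measurable_fst, permuton1_map_fst, half_smul_map_unifI]
  rw [show (Prod.fst ∘ fun t : ℝ => (t, 1 / 2 + t)) = id from rfl, Measure.map_id]
  norm_num only
  exact restrict_Icc_add_half

theorem permuton2_map_snd : permuton2.map Prod.snd = unifI := by
  have h : unifI.map (fun y => y / 2) = unifI.map (fun y => (y + 0) / 2) := by simp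
  rw [permuton2, Measure.map_add _ _ measurable_snd, Measure.map_smul,
    Measure.map_map measurable_snd measurable_diagonal,
    Measure.map_map measurable_snd measurable_toLowerRight,
    show Prod.snd ∘ toLowerRight = (fun x => x / 2) ∘ Prod.snd from rfl,
    ← Measure.map_map (by fun_prop) measurable_snd, permuton1_map_snd, h, half_smul_map_unifI]
  have h2 : (fun t : ℝ => 1 / 2 + t) ⁻¹' (Set.Icc (1 / 2) 1) = Set.Icc 0 (1 / 2) := by
    ext x
    simp only [Set.mem_preimage, Set.mem_Icc]
    constructor <;> rintro ⟨h1, h2⟩ <;> constructor <;> linarith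
  rw [show (Prod.snd ∘ fun t : ℝ => (t, 1 / 2 + t)) = fun t => 1 / 2 + t from rfl, ← h2,
    ← Measure.restrict_map (by fun_prop) measurableSet_Icc, map_add_left_eq_self, add_comm,
    ← restrict_Icc_add_half]
  norm_num

theorem isPermuton_permuton2 : IsPermuton permuton2 := ⟨permuton2_map_fst, permuton2_map_snd⟩

instance : IsProbabilityMeasure permuton2 := isPermuton_permuton2.isProbabilityMeasure

/-! ### The two pieces of the second permuton and its left edge -/

theorem permuton2_segment :
    permuton2 (segment ℝ ((0 : ℝ), (1 / 2 : ℝ)) ((1 / 2 : ℝ), (1 : ℝ))) = 1 / 2 := by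
  have hseg : segment ℝ ((0 : ℝ), (1 / 2 : ℝ)) ((1 / 2 : ℝ), (1 : ℝ)) =
      {p | 0 ≤ p.1 ∧ p.1 ≤ 1 / 2 ∧ p.2 = 1 / 2 + p.1} := by
    ext ⟨x, y⟩
    rw [segment_eq_image]
    simp only [Set.mem_image, Set.mem_Icc, Set.mem_ofPred_eq, Prod.smul_mk, Prod.mk_add_mk,
      Prod.mk.injEq, smul_eq_mul]
    constructor
    · rintro ⟨θ, ⟨h0, h1⟩, rfl, rfl⟩
      refine ⟨by linarith, by linarith, by ring⟩
    · rintro ⟨h0, h1, rfl⟩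
      exact ⟨2 * x, ⟨by linarith, by linarith⟩, by ring, by ring⟩
  have hm : MeasurableSet {p : ℝ × ℝ | 0 ≤ p.1 ∧ p.1 ≤ 1 / 2 ∧ p.2 = 1 / 2 + p.1} := by
    refine (measurableSet_le measurable_const measurable_fst).inter
      ((measurableSet_le measurable_fst measurable_const).inter
        (measurableSet_eq_fun measurable_snd (by fun_prop)))
  rw [hseg, permuton2, Measure.add_apply, Measure.smul_apply,
    Measure.map_apply measurable_diagonal hm, Measure.map_apply measurable_toLowerRight hm]
  have h1 : (fun t : ℝ => (t, 1 / 2 + t)) ⁻¹' {p | 0 ≤ p.1 ∧ p.1 ≤ 1 / 2 ∧ p.2 = 1 / 2 + p.1} =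
      Set.Icc 0 (1 / 2) := by
    ext t; simp
  have h2 : permuton1 (toLowerRight ⁻¹' {p | 0 ≤ p.1 ∧ p.1 ≤ 1 / 2 ∧ p.2 = 1 / 2 + p.1}) = 0 := by
    have := isPermuton_permuton1.ae_fst ae_unifI_mem_Ioo
    rw [ae_iff] at this
    refine measure_mono_null (fun p hp => ?_) this
    simp only [toLowerRight, Set.mem_preimage, Set.mem_ofPred_eq, Set.mem_Ioo] at hp ⊢
    intro h
    linarith [hp.2.1, h.1]
  rw [h1, h2]
  simp

theorem permuton2_restrict :
    permuton2.restrict (Set.Icc (1 / 2 : ℝ) 1 ×ˢ Set.Icc (0 : ℝ) (1 / 2)) =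
      (1 / 2 : ℝ≥0∞) • permuton1.map toLowerRight := by
  have hm : MeasurableSet (Set.Icc (1 / 2 : ℝ) 1 ×ˢ Set.Icc (0 : ℝ) (1 / 2)) :=
    measurableSet_Icc.prod measurableSet_Icc
  rw [permuton2, Measure.restrict_add, Measure.restrict_smul]
  have h1 : ((volume.restrict (Set.Icc (0 : ℝ) (1 / 2))).map (fun t : ℝ => (t, 1 / 2 + t))).restrict
      (Set.Icc (1 / 2 : ℝ) 1 ×ˢ Set.Icc (0 : ℝ) (1 / 2)) = 0 := by
    rw [Measure.restrict_eq_zero, Measure.map_apply measurable_diagonal hm]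
    convert measure_empty (μ := volume.restrict (Set.Icc (0 : ℝ) (1 / 2)))
    ext t
    simp only [Set.mem_preimage, Set.mem_prod, Set.mem_Icc, Set.mem_empty_iff_false, iff_false]
    intro h
    linarith [h.1.1, h.2.2]
  rw [h1, zero_add, Measure.restrict_eq_self_of_ae_mem]
  refine (ae_map_iff measurable_toLowerRight.aemeasurable hm).2 ?_
  filter_upwards [isPermuton_permuton1.ae_fst ae_unifI_mem_Ioo,
    isPermuton_permuton1.ae_snd ae_unifI_mem_Ioo] with p h1 h2
  simp only [toLowerRight]
  exact ⟨⟨by linarith [h1.1], by linarith [h1.2]⟩, by linarith [h2.1], by linarith [h2.2]⟩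

theorem integral_permuton2 (h : ℝ × ℝ → ℝ) (hm : Measurable h) (hb : ∃ M : ℝ, ∀ p, |h p| ≤ M) :
    ∫ p, h p ∂permuton2 =
      (∫ t in (0 : ℝ)..(1 / 2), h (t, 1 / 2 + t)) +
        ∫ p, 1 / 2 * h ((p.1 + 1) / 2, p.2 / 2) ∂permuton1 := by
  obtain ⟨M, hM⟩ := hb
  have hi : ∀ ν : Measure (ℝ × ℝ), IsFiniteMeasure ν → Integrable h ν := fun ν _ =>
    Integrable.of_bound hm.aestronglyMeasurable M (ae_of_all _ hM)
  have hi1 := hi ((volume.restrict (Set.Icc (0 : ℝ) (1 / 2))).map (fun t : ℝ => (t, 1 / 2 + t)))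
    inferInstance
  have hi2 := (hi (permuton1.map toLowerRight) inferInstance).smul_measure
    (c := (1 / 2 : ℝ≥0∞)) (by simp)
  rw [permuton2, integral_add_measure hi1 hi2, integral_smul_measure,
    integral_map measurable_diagonal.aemeasurable hm.aestronglyMeasurable,
    integral_map measurable_toLowerRight.aemeasurable hm.aestronglyMeasurable,
    integral_Icc_eq_integral_Ioc, ← intervalIntegral.integral_of_le (by norm_num),
    integral_const_mul]
  simp [toLowerRight]

/-- For `x < 1/2` the strip meets only the segment, so the tested integral is the average of `f (1/2
+ t)` over `[0, x]`. This is a difference quotient at `0`, with limit `f (1/2)` by the fundamental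
theorem of calculus. -/
theorem hasLeftEdgeLimit_permuton2 : HasLeftEdgeLimit permuton2 (Measure.dirac (1 / 2)) := by
  intro f
  rw [integral_dirac]
  have hc : Continuous fun t : ℝ => f (1 / 2 + t) := f.continuous.comp (by fun_prop)
  have hd : HasDerivAt (fun x : ℝ => ∫ t in (0 : ℝ)..x, f (1 / 2 + t)) (f (1 / 2 + 0)) 0 :=
    intervalIntegral.integral_hasDerivAt_right (hc.intervalIntegrable _ _)
      (hc.stronglyMeasurableAtFilter _ _) hc.continuousAt
  rw [hasDerivAt_iff_tendsto_slope_zero, add_zero] at hd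
  have hd' := hd.mono_left (nhdsWithin_mono (0 : ℝ) (fun x (hx : 0 < x) => ne_of_gt hx))
  refine hd'.congr' ?_
  filter_upwards [Ioo_mem_nhdsGT (show (0 : ℝ) < 1 / 2 by norm_num)] with x hx
  have hms : MeasurableSet (Set.Icc 0 x ×ˢ (Set.univ : Set ℝ)) := measurableSet_Icc.prod .univ
  have hr : permuton2.restrict (Set.Icc 0 x ×ˢ Set.univ) =
      (volume.restrict (Set.Icc 0 x)).map (fun t : ℝ => (t, 1 / 2 + t)) := by
    rw [permuton2, Measure.restrict_add, Measure.restrict_smul]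
    have h1 : (permuton1.map toLowerRight).restrict (Set.Icc 0 x ×ˢ Set.univ) = 0 := by
      rw [Measure.restrict_eq_zero, Measure.map_apply measurable_toLowerRight hms]
      have := isPermuton_permuton1.ae_fst ae_unifI_mem_Ioo
      rw [ae_iff] at this
      refine measure_mono_null (fun p hp => ?_) this
      simp only [toLowerRight, Set.mem_preimage, Set.mem_ofPred_eq, Set.mem_Ioo, Set.mem_prod,
        Set.mem_Icc] at hp ⊢
      intro h
      linarith [hp.1.2, h.1, hx.2]
    rw [h1, smul_zero, add_zero, Measure.restrict_map measurable_diagonal hms,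
      Measure.restrict_restrict (measurable_diagonal hms)]
    congr 2
    ext t
    simp only [Set.mem_inter_iff, Set.mem_preimage, Set.mem_prod, Set.mem_Icc, Set.mem_univ,
      and_true]
    exact ⟨fun h => h.1, fun h => ⟨h, h.1, by linarith [hx.2, h.2]⟩⟩
  rw [leftEdgeMeasure, hr, Measure.map_map measurable_snd measurable_diagonal,
    integral_smul_measure, integral_map (by fun_prop) f.continuous.aestronglyMeasurable,
    integral_Icc_eq_integral_Ioc, ← intervalIntegral.integral_of_le hx.1.le]
  simp [ENNReal.toReal_ofReal hx.1.le]

theorem ae_isSupported_permuton2 : ∀ᵐ p ∂permuton2, IsSupported p := by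
  have hm : MeasurableSet {p | IsSupported p} := by
    unfold IsSupported
    refine MeasurableSet.union ?_ ?_
    · exact (measurableSet_lt measurable_const measurable_fst).inter
        ((measurableSet_lt measurable_fst measurable_const).inter
          (measurableSet_eq_fun measurable_snd (by fun_prop)))
    · exact (measurableSet_lt measurable_const measurable_fst).inter
        ((measurableSet_lt measurable_fst measurable_const).inter
          ((measurableSet_lt measurable_const measurable_snd).inter
            (measurableSet_lt measurable_snd measurable_const)))
  rw [permuton2, ae_add_measure_iff]
  constructor
  · refine (ae_map_iff measurable_diagonal.aemeasurable hm).2 ?_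
    rw [← restrict_Ioo_eq_restrict_Icc]
    filter_upwards [ae_restrict_mem measurableSet_Ioo] with t ht
    exact Or.inl ⟨ht.1, ht.2, rfl⟩
  · refine Measure.ae_smul_measure ?_ _
    refine (ae_map_iff measurable_toLowerRight.aemeasurable hm).2 ?_
    filter_upwards [isPermuton_permuton1.ae_fst ae_unifI_mem_Ioo,
      isPermuton_permuton1.ae_snd ae_unifI_mem_Ioo] with p h1 h2
    refine Or.inr ?_
    simp only [toLowerRight]
    exact ⟨by linarith [h1.1], by linarith [h1.2], by linarith [h2.1], by linarith [h2.2]⟩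

/-- In the coordinates of `μ⁽¹⁾`, `3/2 - (x + 1)/2 = 1 - x/2`, and integrating out the ordinate
leaves its mean `1/2 - densityDev x / 4`. The prefactor `1/4` is the mass `1/2` of the copy times
the vertical scale `1/2`. -/
theorem integral_lowerRight_pow_mul (m : ℕ) :
    ∫ p in {p : ℝ × ℝ | 1 / 2 < p.1}, (3 / 2 - p.1) ^ m * p.2 ∂permuton2 =
      1 / 4 * ∫ x in (0 : ℝ)..1, (1 - x / 2) ^ m * (1 / 2 - densityDev x / 4) := by
  have hm : MeasurableSet {p : ℝ × ℝ | 1 / 2 < p.1} := measurableSet_lt measurable_const measurable_fst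
  have hr : permuton2.restrict {p : ℝ × ℝ | 1 / 2 < p.1} =
      (1 / 2 : ℝ≥0∞) • permuton1.map toLowerRight := by
    rw [← permuton2_restrict]
    refine Measure.restrict_congr_set ?_
    filter_upwards [ae_isSupported_permuton2, isPermuton_permuton2.ae_fst
      (ae_unifI_ne (1 / 2))] with p hp hne
    refine propext ⟨fun h => ?_, fun h => lt_of_le_of_ne h.1.1 (Ne.symm hne)⟩
    rcases hp with hp | hp
    · exact absurd hp.2.1 (not_lt.2 (le_of_lt h))
    · exact ⟨⟨hp.1.le, hp.2.1.le⟩, hp.2.2.1.le, hp.2.2.2.le⟩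
  rw [hr, integral_smul_measure, integral_map measurable_toLowerRight.aemeasurable
    (by fun_prop : Measurable fun p : ℝ × ℝ => (3 / 2 - p.1) ^ m * p.2).aestronglyMeasurable,
    permuton1_eq, integral_withDensity_eq_integral_toReal_smul
      measurable_density.ennreal_ofReal (by simp)]
  have hfm : Measurable fun p : ℝ × ℝ => (1 + densityDev p.1 * heightSign p.2) *
      ((1 - p.1 / 2) ^ m * (p.2 / 2)) := measurable_density.mul (by fun_prop)
  have hae : ∀ᵐ p ∂(unifI.prod unifI), p.1 ∈ Set.Icc (0 : ℝ) 1 ∧ p.2 ∈ Set.Icc (0 : ℝ) 1 := by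
    have h := ae_restrict_mem (μ := (volume : Measure ℝ)) (measurableSet_Icc (a := (0 : ℝ)) (b := 1))
    exact (Measure.quasiMeasurePreserving_fst.ae h).and (Measure.quasiMeasurePreserving_snd.ae h)
  have hi : Integrable (fun p : ℝ × ℝ => (1 + densityDev p.1 * heightSign p.2) *
      ((1 - p.1 / 2) ^ m * (p.2 / 2))) (unifI.prod unifI) := by
    refine Integrable.of_bound hfm.aestronglyMeasurable 2 ?_
    filter_upwards [hae] with p hp
    have h1 : 0 ≤ 1 - p.1 / 2 := by linarith [hp.1.2]
    have h2 : 1 - p.1 / 2 ≤ 1 := by linarith [hp.1.1]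
    have h3 : (1 - p.1 / 2) ^ m * (p.2 / 2) ≤ 1 :=
      mul_le_one₀ (pow_le_one₀ h1 h2) (by linarith [hp.2.1]) (by linarith [hp.2.2])
    have h4 : 0 ≤ (1 - p.1 / 2) ^ m * (p.2 / 2) :=
      mul_nonneg (pow_nonneg h1 m) (by linarith [hp.2.1])
    rw [Real.norm_eq_abs, abs_of_nonneg (mul_nonneg (density_nonneg _ _) h4)]
    nlinarith [density_nonneg p.1 p.2, density_le p.1 p.2]
  have he : ∀ p : ℝ × ℝ, (ENNReal.ofReal (1 + densityDev p.1 * heightSign p.2)).toReal •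
      ((3 / 2 - (toLowerRight p).1) ^ m * (toLowerRight p).2) =
      (1 + densityDev p.1 * heightSign p.2) * ((1 - p.1 / 2) ^ m * (p.2 / 2)) := by
    intro p
    rw [ENNReal.toReal_ofReal (density_nonneg _ _), smul_eq_mul, toLowerRight]
    congr 3
    ring
  simp_rw [he]
  rw [integral_prod _ hi, ← integral_unifI, ← integral_const_mul, ← integral_smul]
  refine integral_congr_ae (ae_of_all _ fun x => ?_)
  have hid : Integrable (fun y : ℝ => y) unifI :=
    integrable_unifI_of_abs_le measurable_id 1 fun x hx => abs_le.2 ⟨by linarith [hx.1], hx.2⟩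
  have hid' : ∫ y, y ∂unifI = 1 / 2 := by rw [integral_unifI, integral_id]; norm_num
  have : ∀ y : ℝ, (1 + densityDev x * heightSign y) * ((1 - x / 2) ^ m * (y / 2)) =
      (1 - x / 2) ^ m / 2 * (y + densityDev x * (y * heightSign y)) := fun y => by ring
  simp only [this]
  rw [integral_const_mul, integral_add hid (integrable_mul_heightSign.const_mul _),
    integral_const_mul, integral_mul_heightSign, hid']
  simp
  ring

/-! ### The expected size of the subtree at the word `00` -/

section Sampling

variable {μ : Measure (ℝ × ℝ)} [IsProbabilityMeasure μ]

/-- Given the point `i`, the other points are independent: one must lie to its lower right and the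
remaining `m` must avoid the strip. Indexing the partner by `i.succAbove j` builds in that it
differs from `i`. -/
theorem pi_pair_eq_lintegral {m : ℕ} (i : Fin (m + 2)) (j : Fin (m + 1)) :
    MeasurableSet {ω : Fin (m + 2) → ℝ × ℝ | IsLeftmostPair ω i (i.succAbove j)} ∧
    (Measure.pi fun _ : Fin (m + 2) => μ) {ω | IsLeftmostPair ω i (i.succAbove j)} =
      ∫⁻ p in {p : ℝ × ℝ | 1 / 2 < p.1}, μ {q | p.1 < q.1 ∧ q.2 < p.2} *
        μ {q | q.1 ∉ Set.Ioo (1 / 2) p.1} ^ m ∂μ := by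
  let A : Set ((ℝ × ℝ) × (Fin (m + 1) → ℝ × ℝ)) := {z | 1 / 2 < z.1.1 ∧
    (z.1.1 < (z.2 j).1 ∧ (z.2 j).2 < z.1.2) ∧ ∀ k, k ≠ j → (z.2 k).1 ∉ Set.Ioo (1 / 2) z.1.1}
  have hA : MeasurableSet A := by
    have h1 : MeasurableSet {z : (ℝ × ℝ) × (Fin (m + 1) → ℝ × ℝ) | 1 / 2 < z.1.1} :=
      measurableSet_lt (by fun_prop) (by fun_prop)
    have h2 : MeasurableSet {z : (ℝ × ℝ) × (Fin (m + 1) → ℝ × ℝ) | z.1.1 < (z.2 j).1} :=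
      measurableSet_lt (by fun_prop) (by fun_prop)
    have h3 : MeasurableSet {z : (ℝ × ℝ) × (Fin (m + 1) → ℝ × ℝ) | (z.2 j).2 < z.1.2} :=
      measurableSet_lt (by fun_prop) (by fun_prop)
    have : {z : (ℝ × ℝ) × (Fin (m + 1) → ℝ × ℝ) |
        ∀ k, k ≠ j → (z.2 k).1 ∉ Set.Ioo (1 / 2) z.1.1} =
        ⋂ k, ⋂ (_ : k ≠ j), ({z | 1 / 2 < (z.2 k).1} ∩ {z | (z.2 k).1 < z.1.1})ᶜ := by
      ext z; simp
    have h4 : MeasurableSet {z : (ℝ × ℝ) × (Fin (m + 1) → ℝ × ℝ) |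
        ∀ k, k ≠ j → (z.2 k).1 ∉ Set.Ioo (1 / 2) z.1.1} := by
      rw [this]
      exact MeasurableSet.iInter fun k => MeasurableSet.iInter fun _ =>
        ((measurableSet_lt (by fun_prop) (by fun_prop)).inter
          (measurableSet_lt (by fun_prop) (by fun_prop))).compl
    exact h1.inter ((h2.inter h3).inter h4)
  have hpre : {ω : Fin (m + 2) → ℝ × ℝ | IsLeftmostPair ω i (i.succAbove j)} =
      MeasurableEquiv.piFinSuccAbove (fun _ => ℝ × ℝ) i ⁻¹' A := by
    ext ω
    simp only [Set.mem_ofPred_eq, Set.mem_preimage, A, IsLeftmostPair,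
      MeasurableEquiv.piFinSuccAbove_apply, Fin.insertNthEquiv_symm_apply, Fin.removeNth]
    refine and_congr_right fun _ => ?_
    rw [and_assoc]
    refine and_congr_right fun _ => and_congr_right fun _ => ⟨fun h k hk => ?_, fun h k hk hk' => ?_⟩
    · exact h _ (Fin.succAbove_ne i k) fun he => hk (Fin.succAbove_right_injective he)
    · obtain ⟨k, rfl⟩ := Fin.exists_succAbove_eq hk
      exact h k fun he => hk' (by rw [he])
  refine ⟨hpre ▸ (MeasurableEquiv.measurable _) hA, ?_⟩
  rw [hpre, (measurePreserving_piFinSuccAbove (fun _ => μ) i).measure_preimage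
    hA.nullMeasurableSet, Measure.prod_apply hA, ← lintegral_indicator
      (measurableSet_lt measurable_const measurable_fst)]
  refine lintegral_congr fun p => ?_
  by_cases hp : 1 / 2 < p.1
  · rw [Set.indicator_of_mem (by exact hp)]
    -- The section at `p` is a box, so its measure is a product.
    have : Prod.mk p ⁻¹' A = Set.univ.pi fun k => if k = j then {q : ℝ × ℝ | p.1 < q.1 ∧ q.2 < p.2}
        else {q | q.1 ∉ Set.Ioo (1 / 2) p.1} := by
      ext ω
      simp only [A, Set.mem_preimage, Set.mem_ofPred_eq, hp, true_and, Set.mem_univ_pi]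
      constructor
      · rintro ⟨h1, h2⟩ k
        split_ifs with hk
        · subst hk; exact h1
        · exact h2 k hk
      · intro h
        refine ⟨by simpa using h j, fun k hk => ?_⟩
        have := h k
        rw [if_neg hk] at this
        exact this
    rw [this, Measure.pi_pi, Fin.prod_univ_succAbove _ j]
    simp [Fin.succAbove_ne]
  · rw [Set.indicator_of_notMem (by exact hp)]
    have : Prod.mk p ⁻¹' A = ∅ := by
      ext ω
      simp only [A, Set.mem_preimage, Set.mem_ofPred_eq, hp, false_and, Set.mem_empty_iff_false]
    rw [this, measure_empty]

theorem ae_pi_forall {n : ℕ} {P : ℝ × ℝ → Prop} (h : ∀ᵐ p ∂μ, P p) :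
    ∀ᵐ ω ∂(Measure.pi fun _ : Fin n => μ), ∀ i, P (ω i) :=
  ae_all_iff.2 fun i => (Measure.quasiMeasurePreserving_eval (fun _ => μ) i).ae h

theorem ae_pi_injective_fst (n : ℕ) (h : ∀ x, μ {q | q.1 = x} = 0) :
    ∀ᵐ ω ∂(Measure.pi fun _ : Fin n => μ), Function.Injective fun i => (ω i).1 := by
  have key : ∀ i j : Fin n, i ≠ j →
      ∀ᵐ ω ∂(Measure.pi fun _ : Fin n => μ), (ω i).1 ≠ (ω j).1 := by
    intro i j hij
    cases n with
    | zero => exact i.elim0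
    | succ n =>
      obtain ⟨k, rfl⟩ := Fin.exists_succAbove_eq hij.symm
      have hm : MeasurableSet {z : (ℝ × ℝ) × (Fin n → ℝ × ℝ) | (z.2 k).1 = z.1.1} :=
        measurableSet_eq_fun (by fun_prop) (by fun_prop)
      have h0 : (μ.prod (Measure.pi fun _ : Fin n => μ)) {z | (z.2 k).1 = z.1.1} = 0 := by
        rw [Measure.measure_prod_null hm]
        refine ae_of_all _ fun p => ?_
        exact (Measure.quasiMeasurePreserving_eval (fun _ : Fin n => μ) k).preimage_null (h p.1)
      have := (measurePreserving_piFinSuccAbove (fun _ => μ) i).quasiMeasurePreserving.preimage_null h0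
      rw [ae_iff]
      refine measure_mono_null (fun ω hω => ?_) this
      simp only [Set.mem_ofPred_eq, ne_eq, not_not] at hω
      exact hω.symm
  have : ∀ᵐ ω ∂(Measure.pi fun _ : Fin n => μ), ∀ i j : Fin n, i ≠ j → (ω i).1 ≠ (ω j).1 := by
    simp only [ae_all_iff]
    exact fun i j hij => key i j hij
  filter_upwards [this] with ω hω i j hij
  by_contra hne
  exact hω i j hne hij

open Classical in
/-- The number of pairs made of the leftmost point of the right half and of a point to its lower
right. -/
noncomputable def leftmostPairCount {n : ℕ} (ω : Fin n → ℝ × ℝ) : ℝ :=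
  ∑ i, ∑ j, if IsLeftmostPair ω i j then 1 else 0

theorem leftmostPairCount_nonneg {n : ℕ} (ω : Fin n → ℝ × ℝ) : 0 ≤ leftmostPairCount ω :=
  Finset.sum_nonneg fun i _ => Finset.sum_nonneg fun j _ => by split_ifs <;> norm_num

theorem leftmostPairCount_le {n : ℕ} (ω : Fin n → ℝ × ℝ) : leftmostPairCount ω ≤ n * n := by
  classical
  calc leftmostPairCount ω ≤ ∑ _i : Fin n, ∑ _j : Fin n, (1 : ℝ) :=
        Finset.sum_le_sum fun i _ => Finset.sum_le_sum fun j _ => by split_ifs <;> norm_num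
    _ = n * n := by simp

theorem leftmostPairCount_eq {m : ℕ} (ω : Fin (m + 2) → ℝ × ℝ) :
    leftmostPairCount ω = ∑ i, ∑ j : Fin (m + 1),
      {ω : Fin (m + 2) → ℝ × ℝ | IsLeftmostPair ω i (i.succAbove j)}.indicator 1 ω := by
  classical
  refine Finset.sum_congr rfl fun i _ => ?_
  -- The diagonal term vanishes: a point is not to the right of itself.
  rw [Fin.sum_univ_succAbove _ i, if_neg (fun h => lt_irrefl _ h.2.1), zero_add]
  simp [Set.indicator]

variable (μ) in
/-- The probability that two given points of a sample of `m + 2` points are the leftmost point of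
the right half and a point to its lower right. -/
noncomputable def leftmostPairProb (m : ℕ) : ℝ :=
  (∫⁻ p in {p : ℝ × ℝ | 1 / 2 < p.1}, μ {q | p.1 < q.1 ∧ q.2 < p.2} *
        μ {q | q.1 ∉ Set.Ioo (1 / 2) p.1} ^ m ∂μ).toReal

theorem integrable_leftmostPairCount (m : ℕ) :
    Integrable (leftmostPairCount (n := m + 2)) (Measure.pi fun _ : Fin (m + 2) => μ) := by
  simp_rw [funext (leftmostPairCount_eq (m := m))]
  exact integrable_finsetSum _ fun i _ => integrable_finsetSum _ fun j _ =>
    (integrable_const (1 : ℝ)).indicator (pi_pair_eq_lintegral (μ := μ) i j).1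

theorem integral_leftmostPairCount (m : ℕ) :
    ∫ ω, leftmostPairCount ω ∂(Measure.pi fun _ : Fin (m + 2) => μ) =
      (m + 2) * ((m + 1) * leftmostPairProb μ m) := by
  simp_rw [leftmostPairCount_eq]
  have hi : ∀ (i : Fin (m + 2)) (j : Fin (m + 1)), Integrable
      ({ω : Fin (m + 2) → ℝ × ℝ | IsLeftmostPair ω i (i.succAbove j)}.indicator (1 : (Fin (m + 2) → ℝ × ℝ) → ℝ))
      (Measure.pi fun _ : Fin (m + 2) => μ) := fun i j =>
    (integrable_const (1 : ℝ)).indicator (pi_pair_eq_lintegral (μ := μ) i j).1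
  rw [integral_finsetSum _ fun i _ => integrable_finsetSum _ fun j _ => hi i j]
  have : ∀ i : Fin (m + 2), ∫ ω, ∑ j : Fin (m + 1),
      {ω : Fin (m + 2) → ℝ × ℝ | IsLeftmostPair ω i (i.succAbove j)}.indicator (1 : (Fin (m + 2) → ℝ × ℝ) → ℝ) ω
        ∂(Measure.pi fun _ : Fin (m + 2) => μ) = (m + 1) * leftmostPairProb μ m := by
    intro i
    rw [integral_finsetSum _ fun j _ => hi i j]
    have : ∀ j : Fin (m + 1), ∫ ω,
        {ω : Fin (m + 2) → ℝ × ℝ | IsLeftmostPair ω i (i.succAbove j)}.indicator (1 : (Fin (m + 2) → ℝ × ℝ) → ℝ) ω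
        ∂(Measure.pi fun _ : Fin (m + 2) => μ) = leftmostPairProb μ m := by
      intro j
      rw [integral_indicator_one (pi_pair_eq_lintegral (μ := μ) i j).1, Measure.real,
        (pi_pair_eq_lintegral (μ := μ) i j).2, leftmostPairProb]
    simp [this]
  simp [this]

theorem card_treeNodes_bstOfPoints {n : ℕ} (ω : Fin n → ℝ × ℝ) :
    (treeNodes (bstOfPoints ω)).card = n := by
  rw [card_treeNodes, bstOfPoints, numNodes_bst, sortedOrdinates, List.length_ofFn]

/-- Almost surely, the proportion equals the pair count over `m + 2` unless no point falls in the
left half. On that event, of probability `(1/2)^(m + 2)`, the crude bounds `1` and `(m + 2)^2 / (m +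
2)` suffice. -/
theorem abs_integral_subtreeProfile_sub_le (hs : ∀ᵐ p ∂μ, IsSupported p)
    (h0 : ∀ x, μ {q | q.1 = x} = 0) (hhalf : μ {q | ¬ q.1 < 1 / 2} = 1 / 2) (m : ℕ) :
    |∫ ω, subtreeProfile (m + 2) ω [false, false] ∂(Measure.pi fun _ : Fin (m + 2) => μ) -
      (m + 1) * leftmostPairProb μ m| ≤ (m + 3) * (1 / 2) ^ (m + 2) := by
  let ν := Measure.pi fun _ : Fin (m + 2) => μ
  let B : Set (Fin (m + 2) → ℝ × ℝ) := Set.univ.pi fun _ => {q | ¬ q.1 < 1 / 2}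
  have hB : MeasurableSet B := MeasurableSet.univ_pi fun _ =>
    (measurableSet_lt measurable_fst measurable_const).compl
  have hνB : ν.real B = (1 / 2) ^ (m + 2) := by
    simp only [ν, B, Measure.real, Measure.pi_pi, hhalf]
    simp
  have hT : ∀ ω, subtreeProfile (m + 2) ω [false, false] ∈ Set.Icc (0 : ℝ) 1 := fun ω =>
    subtreeProportion_mem_Icc _ _
  have hTi : Integrable (fun ω => subtreeProfile (m + 2) ω [false, false]) ν := by
    refine Integrable.of_bound
      (((measurable_pi_apply _).comp (measurable_subtreeProfile _)).aestronglyMeasurable) 1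
      (ae_of_all _ fun ω => ?_)
    rw [Real.norm_eq_abs, abs_of_nonneg (hT ω).1]
    exact (hT ω).2
  have hKi := (integrable_leftmostPairCount (μ := μ) m).div_const ((m : ℝ) + 2)
  have hK : (m + 1) * leftmostPairProb μ m = ∫ ω, leftmostPairCount ω / ((m : ℝ) + 2) ∂ν := by
    rw [integral_div, integral_leftmostPairCount]
    field_simp
  have hBi : Integrable (B.indicator fun _ => (m : ℝ) + 3) ν := (integrable_const _).indicator hB
  rw [hK, ← integral_sub hTi hKi, ← hνB, ← Real.norm_eq_abs]
  refine (norm_integral_le_of_norm_le hBi ?_).trans_eq ?_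
  · filter_upwards [ae_pi_forall (n := m + 2) hs, ae_pi_injective_fst (m + 2) h0] with ω h1 h2
    by_cases hω : ω ∈ B
    · rw [Set.indicator_of_mem hω, Real.norm_eq_abs, abs_le]
      have h3 : 0 ≤ leftmostPairCount ω / ((m : ℝ) + 2) :=
        div_nonneg (leftmostPairCount_nonneg ω) (by positivity)
      have h4 : leftmostPairCount ω / ((m : ℝ) + 2) ≤ m + 2 := by
        rw [div_le_iff₀ (by positivity)]
        simpa using leftmostPairCount_le ω
      constructor <;> linarith [(hT ω).1, (hT ω).2, (Nat.cast_nonneg m : (0 : ℝ) ≤ m)]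
    · rw [Set.indicator_of_notMem hω]
      have hex : ∃ i, (ω i).1 < 1 / 2 := by
        by_contra hne
        push Not at hne
        exact hω fun i _ => not_lt.2 (hne i)
      have := card_leftmostPairs ω h1 h2 hex
      have he : subtreeProfile (m + 2) ω [false, false] =
          leftmostPairCount ω / ((m : ℝ) + 2) := by
        rw [subtreeProfile, subtreeProportion, card_treeNodes_bstOfPoints, leftmostPairCount,
          this]
        push_cast
        rfl
      rw [he, sub_self, norm_zero]
  · rw [integral_indicator_const _ hB, smul_eq_mul, mul_comm]

end Sampling

/-! ### Absence of convergence -/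

theorem IsPermuton.measure_fst {μ : Measure (ℝ × ℝ)} (h : IsPermuton μ) {s : Set ℝ}
    (hs : MeasurableSet s) : μ {q | q.1 ∈ s} = unifI s := by
  rw [unifI, ← h.1, Measure.map_apply measurable_fst hs]
  rfl

theorem IsPermuton.measure_snd {μ : Measure (ℝ × ℝ)} (h : IsPermuton μ) {s : Set ℝ}
    (hs : MeasurableSet s) : μ {q | q.2 ∈ s} = unifI s := by
  rw [unifI, ← h.2, Measure.map_apply measurable_snd hs]
  rfl

/-! ### Estimate of the pair probability -/

theorem measurable_measure_lowerRight (μ : Measure (ℝ × ℝ)) [IsProbabilityMeasure μ] :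
    Measurable fun p : ℝ × ℝ => μ {q | p.1 < q.1 ∧ q.2 < p.2} := by
  have h1 : MeasurableSet {z : (ℝ × ℝ) × (ℝ × ℝ) | z.1.1 < z.2.1} :=
    measurableSet_lt (by fun_prop) (by fun_prop)
  have h2 : MeasurableSet {z : (ℝ × ℝ) × (ℝ × ℝ) | z.2.2 < z.1.2} :=
    measurableSet_lt (by fun_prop) (by fun_prop)
  exact measurable_measure_prodMk_left (h1.inter h2)

theorem measurable_measure_notMem_Ioo (μ : Measure (ℝ × ℝ)) [IsProbabilityMeasure μ] :
    Measurable fun p : ℝ × ℝ => μ {q | q.1 ∉ Set.Ioo (1 / 2) p.1} := by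
  have h1 : MeasurableSet {z : (ℝ × ℝ) × (ℝ × ℝ) | 1 / 2 < z.2.1} :=
    measurableSet_lt (by fun_prop) (by fun_prop)
  have h2 : MeasurableSet {z : (ℝ × ℝ) × (ℝ × ℝ) | z.2.1 < z.1.1} :=
    measurableSet_lt (by fun_prop) (by fun_prop)
  exact measurable_measure_prodMk_left (h1.inter h2).compl

theorem permuton2_real_notMem_Ioo {x : ℝ} (h1 : 1 / 2 < x) (h2 : x < 1) :
    permuton2.real {q | q.1 ∉ Set.Ioo (1 / 2) x} = 3 / 2 - x := by
  have hi : permuton2.real {q | q.1 ∈ Set.Ioo (1 / 2) x} = x - 1 / 2 := by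
    rw [Measure.real, isPermuton_permuton2.measure_fst measurableSet_Ioo, unifI,
      Measure.restrict_apply measurableSet_Ioo, Set.inter_eq_left.2
        (Set.Ioo_subset_Icc_self.trans (Set.Icc_subset_Icc (by norm_num) (by linarith))), Real.volume_Ioo,
      ENNReal.toReal_ofReal (by linarith)]
  have := probReal_compl_eq_one_sub (μ := permuton2) (s := {q : ℝ × ℝ | q.1 ∈ Set.Ioo (1 / 2) x})
    (measurable_fst measurableSet_Ioo)
  rw [hi] at this
  rw [show {q : ℝ × ℝ | q.1 ∉ Set.Ioo (1 / 2) x} = {q | q.1 ∈ Set.Ioo (1 / 2) x}ᶜ from rfl, this]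
  ring

/-- The points below height `p.2` have mass `p.2` and almost surely lie in the lower right quarter.
Those not to the right of `p` are in a vertical strip of mass `p.1 - 1/2`. -/
theorem permuton2_real_lowerRight {p : ℝ × ℝ} (hx1 : 1 / 2 < p.1) (hx2 : p.1 < 1) (hy1 : 0 < p.2)
    (hy2 : p.2 < 1 / 2) :
    |permuton2.real {q | p.1 < q.1 ∧ q.2 < p.2} - p.2| ≤ p.1 - 1 / 2 := by
  have h1 : permuton2.real {q | q.2 < p.2} = p.2 := by
    rw [Measure.real, show {q : ℝ × ℝ | q.2 < p.2} = {q | q.2 ∈ Set.Iio p.2} from rfl,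
      isPermuton_permuton2.measure_snd measurableSet_Iio, unifI,
      Measure.restrict_apply measurableSet_Iio]
    have : Set.Iio p.2 ∩ Set.Icc 0 1 = Set.Ico 0 p.2 := by
      ext y
      simp only [Set.mem_inter_iff, Set.mem_Iio, Set.mem_Icc, Set.mem_Ico]
      exact ⟨fun h => ⟨h.2.1, h.1⟩, fun h => ⟨h.2, h.1, by linarith [h.2]⟩⟩
    rw [this, Real.volume_Ico, sub_zero, ENNReal.toReal_ofReal hy1.le]
  have h2 : permuton2.real {q | q.1 ∈ Set.Icc (1 / 2) p.1} = p.1 - 1 / 2 := by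
    rw [Measure.real, isPermuton_permuton2.measure_fst measurableSet_Icc, unifI,
      Measure.restrict_apply measurableSet_Icc, Set.inter_eq_left.2 (Set.Icc_subset_Icc
        (by norm_num) (by linarith)), Real.volume_Icc,
      ENNReal.toReal_ofReal (by linarith)]
  have h3 : permuton2.real {q | p.1 < q.1 ∧ q.2 < p.2} ≤ permuton2.real {q | q.2 < p.2} :=
    measureReal_mono fun q hq => hq.2
  have h4 : permuton2.real {q | q.2 < p.2} ≤
      permuton2.real ({q | p.1 < q.1 ∧ q.2 < p.2} ∪ {q | q.1 ∈ Set.Icc (1 / 2) p.1}) := by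
    refine ENNReal.toReal_mono (measure_ne_top _ _) (measure_mono_ae ?_)
    filter_upwards [ae_isSupported_permuton2] with q hq hlt
    have hlt : q.2 < p.2 := hlt
    rcases hq with hq | hq
    · linarith [hq.2.2, hq.1]
    · rcases lt_or_ge p.1 q.1 with h | h
      · exact Or.inl ⟨h, hlt⟩
      · exact Or.inr ⟨hq.1.le, h⟩
  have h5 := measureReal_union_le (μ := permuton2) {q : ℝ × ℝ | p.1 < q.1 ∧ q.2 < p.2}
    {q | q.1 ∈ Set.Icc (1 / 2) p.1}
  rw [abs_le]
  constructor <;> linarith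

theorem leftmostPairProb_permuton2 (m : ℕ) :
    leftmostPairProb permuton2 m = ∫ p in {p : ℝ × ℝ | 1 / 2 < p.1},
      permuton2.real {q | p.1 < q.1 ∧ q.2 < p.2} *
        permuton2.real {q | q.1 ∉ Set.Ioo (1 / 2) p.1} ^ m ∂permuton2 := by
  rw [leftmostPairProb, ← integral_toReal]
  · simp only [ENNReal.toReal_mul, ENNReal.toReal_pow, Measure.real]
  · exact ((measurable_measure_lowerRight _).mul
      ((measurable_measure_notMem_Ioo _).pow_const _)).aemeasurable
  · exact ae_of_all _ fun p => ENNReal.mul_lt_top (measure_lt_top _ _)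
      (ENNReal.pow_lt_top (measure_lt_top _ _))

/-- The integrand depends on the abscissa alone, which is uniform. Substituting `v = 3/2 - x` and
enlarging `[1/2, 1]` to `[0, 1]` gives the Beta value; it stays negligible after multiplication by
`m + 1`. -/
theorem integral_sub_half_mul_pow_le (m : ℕ) :
    ∫ p in {p : ℝ × ℝ | 1 / 2 < p.1}, (p.1 - 1 / 2) * (3 / 2 - p.1) ^ m ∂permuton2 ≤
      1 / ((m + 1) * (m + 2)) := by
  have hmap : ∫ p in {p : ℝ × ℝ | 1 / 2 < p.1}, (p.1 - 1 / 2) * (3 / 2 - p.1) ^ m ∂permuton2 =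
      ∫ x in (1 / 2 : ℝ)..1, (x - 1 / 2) * (3 / 2 - x) ^ m := by
    have h := setIntegral_map (μ := permuton2) (g := Prod.fst) (s := Set.Ioi (1 / 2 : ℝ))
      (f := fun x => (x - 1 / 2) * (3 / 2 - x) ^ m) measurableSet_Ioi
      (by fun_prop : Measurable fun x : ℝ => (x - 1 / 2) * (3 / 2 - x) ^ m).aestronglyMeasurable
      measurable_fst.aemeasurable
    rw [permuton2_map_fst, unifI, Measure.restrict_restrict measurableSet_Ioi] at h
    have hs : Set.Ioi (1 / 2 : ℝ) ∩ Set.Icc 0 1 = Set.Ioc (1 / 2) 1 := by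
      ext y
      simp only [Set.mem_inter_iff, Set.mem_Ioi, Set.mem_Icc, Set.mem_Ioc]
      exact ⟨fun h => ⟨h.1, h.2.2⟩, fun h => ⟨h.1, by linarith [h.1], h.2⟩⟩
    rw [hs, ← intervalIntegral.integral_of_le (by norm_num)] at h
    exact h.symm
  have hsub : ∫ x in (1 / 2 : ℝ)..1, (x - 1 / 2) * (3 / 2 - x) ^ m =
      ∫ v in (1 / 2 : ℝ)..1, (1 - v) * v ^ m := by
    have := intervalIntegral.integral_comp_sub_left (a := 1 / 2) (b := 1)
      (fun v : ℝ => (1 - v) * v ^ m) (3 / 2)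
    norm_num at this
    rw [← this]
    refine intervalIntegral.integral_congr fun x _ => ?_
    ring
  have hcont : Continuous fun v : ℝ => (1 - v) * v ^ m := by fun_prop
  have hle : ∫ v in (1 / 2 : ℝ)..1, (1 - v) * v ^ m ≤ ∫ v in (0 : ℝ)..1, (1 - v) * v ^ m := by
    rw [← intervalIntegral.integral_add_adjacent_intervals (hcont.intervalIntegrable 0 (1 / 2))
      (hcont.intervalIntegrable (1 / 2) 1)]
    have : 0 ≤ ∫ v in (0 : ℝ)..(1 / 2), (1 - v) * v ^ m :=
      intervalIntegral.integral_nonneg (by norm_num) fun v hv =>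
        mul_nonneg (by linarith [hv.2]) (pow_nonneg hv.1 m)
    linarith
  have hval : ∫ v in (0 : ℝ)..1, (1 - v) * v ^ m = 1 / ((m + 1) * (m + 2)) := by
    have : ∀ v : ℝ, (1 - v) * v ^ m = v ^ m - v ^ (m + 1) := fun v => by ring
    simp_rw [this]
    rw [intervalIntegral.integral_sub (by simp) (by simp), integral_pow, integral_pow]
    have h1 : (m : ℝ) + 1 ≠ 0 := by positivity
    have h2 : (m : ℝ) + 2 ≠ 0 := by positivity
    have h3 : (m : ℝ) + 1 + 1 ≠ 0 := by positivity
    push_cast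
    field_simp
    simp
    ring
  rw [hmap, hsub, ← hval]
  exact hle

theorem abs_leftmostPairProb_sub_le (m : ℕ) :
    |leftmostPairProb permuton2 m -
      1 / 4 * ∫ x in (0 : ℝ)..1, (1 - x / 2) ^ m * (1 / 2 - densityDev x / 4)| ≤
      1 / ((m + 1) * (m + 2)) := by
  have hS : MeasurableSet {p : ℝ × ℝ | 1 / 2 < p.1} :=
    measurableSet_lt measurable_const measurable_fst
  have hae : ∀ᵐ p ∂permuton2.restrict {p : ℝ × ℝ | 1 / 2 < p.1},
      1 / 2 < p.1 ∧ p.1 < 1 ∧ 0 < p.2 ∧ p.2 < 1 / 2 := by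
    filter_upwards [ae_restrict_mem hS, ae_restrict_of_ae ae_isSupported_permuton2] with p h1 h2
    rcases h2 with h | h
    · exact absurd h.2.1 (not_lt.2 (le_of_lt h1))
    · exact h
  have hbd : ∀ {f : ℝ × ℝ → ℝ}, Measurable f → (∀ p : ℝ × ℝ, 1 / 2 < p.1 → p.1 < 1 → 0 < p.2 →
      p.2 < 1 / 2 → |f p| ≤ 1) → Integrable f (permuton2.restrict {p : ℝ × ℝ | 1 / 2 < p.1}) := by
    intro f hf h
    refine Integrable.of_bound hf.aestronglyMeasurable 1 ?_
    filter_upwards [hae] with p hp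
    exact h p hp.1 hp.2.1 hp.2.2.1 hp.2.2.2
  have hpow : ∀ x : ℝ, 1 / 2 < x → x < 1 → 0 ≤ (3 / 2 - x) ^ m ∧ (3 / 2 - x) ^ m ≤ 1 :=
    fun x h1 h2 => ⟨pow_nonneg (by linarith) m, pow_le_one₀ (by linarith) (by linarith)⟩
  have hmeas : Measurable fun p : ℝ × ℝ => permuton2.real {q | p.1 < q.1 ∧ q.2 < p.2} :=
    (measurable_measure_lowerRight _).ennreal_toReal
  have hi1 : Integrable (fun p : ℝ × ℝ => permuton2.real {q | p.1 < q.1 ∧ q.2 < p.2} *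
      (3 / 2 - p.1) ^ m) (permuton2.restrict {p : ℝ × ℝ | 1 / 2 < p.1}) := by
    refine hbd (hmeas.mul (by fun_prop)) fun p h1 h2 _ _ => ?_
    rw [abs_of_nonneg (mul_nonneg measureReal_nonneg (hpow _ h1 h2).1)]
    exact mul_le_one₀ measureReal_le_one (hpow _ h1 h2).1 (hpow _ h1 h2).2
  have hi2 : Integrable (fun p : ℝ × ℝ => (3 / 2 - p.1) ^ m * p.2)
      (permuton2.restrict {p : ℝ × ℝ | 1 / 2 < p.1}) := by
    refine hbd (by fun_prop) fun p h1 h2 h3 h4 => ?_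
    rw [abs_of_nonneg (mul_nonneg (hpow _ h1 h2).1 h3.le)]
    exact mul_le_one₀ (hpow _ h1 h2).2 h3.le (by linarith)
  have hi3 : Integrable (fun p : ℝ × ℝ => (p.1 - 1 / 2) * (3 / 2 - p.1) ^ m)
      (permuton2.restrict {p : ℝ × ℝ | 1 / 2 < p.1}) := by
    refine hbd (by fun_prop) fun p h1 h2 h3 h4 => ?_
    rw [abs_of_nonneg (mul_nonneg (by linarith) (hpow _ h1 h2).1)]
    exact mul_le_one₀ (by linarith) (hpow _ h1 h2).1 (hpow _ h1 h2).2
  have hprob : leftmostPairProb permuton2 m = ∫ p in {p : ℝ × ℝ | 1 / 2 < p.1},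
      permuton2.real {q | p.1 < q.1 ∧ q.2 < p.2} * (3 / 2 - p.1) ^ m ∂permuton2 := by
    rw [leftmostPairProb_permuton2]
    refine integral_congr_ae ?_
    filter_upwards [hae] with p hp
    rw [permuton2_real_notMem_Ioo hp.1 hp.2.1]
  rw [hprob, ← integral_lowerRight_pow_mul, ← integral_sub hi1 hi2, ← Real.norm_eq_abs]
  refine le_trans (norm_integral_le_of_norm_le hi3 ?_) (integral_sub_half_mul_pow_le m)
  filter_upwards [hae] with p hp
  rw [show permuton2.real {q | p.1 < q.1 ∧ q.2 < p.2} * (3 / 2 - p.1) ^ m - (3 / 2 - p.1) ^ m * p.2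
    = (permuton2.real {q | p.1 < q.1 ∧ q.2 < p.2} - p.2) * (3 / 2 - p.1) ^ m by ring, norm_mul,
    Real.norm_eq_abs, Real.norm_eq_abs, abs_of_nonneg (hpow _ hp.1 hp.2.1).1]
  exact mul_le_mul_of_nonneg_right
    (permuton2_real_lowerRight hp.1 hp.2.1 hp.2.2.1 hp.2.2.2) (hpow _ hp.1 hp.2.1).1

/-- The value at the word `00`, truncated to `[0, 1]`. -/
noncomputable def evalLeftLeft : (List Bool → ℝ) →ᵇ ℝ :=
  BoundedContinuousFunction.mkOfBound
    ⟨fun ψ => max 0 (min (ψ [false, false]) 1), by fun_prop⟩ 1 fun ψ φ => by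
      simp only [ContinuousMap.coe_mk, Real.dist_eq, abs_le]
      have h1 : ∀ x : ℝ, 0 ≤ max 0 (min x 1) := fun x => le_max_left _ _
      have h2 : ∀ x : ℝ, max 0 (min x 1) ≤ 1 := fun x => max_le zero_le_one (min_le_right _ _)
      constructor <;> linarith [h1 (ψ [false, false]), h2 (ψ [false, false]),
        h1 (φ [false, false]), h2 (φ [false, false])]

/-- Proportions already lie in `[0, 1]`, so the truncation that makes the test function bounded has
no effect on them. -/
theorem integral_evalLeftLeft (μ : Measure (ℝ × ℝ)) (n : ℕ) :
    ∫ ψ, evalLeftLeft ψ ∂(subtreeProfileLaw μ n) =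
      ∫ ω, subtreeProfile n ω [false, false] ∂(Measure.pi fun _ : Fin n => μ) := by
  have hc : Measurable fun ψ : List Bool → ℝ => evalLeftLeft ψ := by
    change Measurable fun ψ : List Bool → ℝ => max 0 (min (ψ [false, false]) 1)
    fun_prop
  rw [subtreeProfileLaw, integral_map (measurable_subtreeProfile n).aemeasurable
    hc.aestronglyMeasurable]
  refine integral_congr_ae (ae_of_all _ fun ω => ?_)
  have h : subtreeProfile n ω [false, false] ∈ Set.Icc (0 : ℝ) 1 := subtreeProportion_mem_Icc _ _
  change max 0 (min (subtreeProfile n ω [false, false]) 1) = _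
  rw [min_eq_left h.2, max_eq_right h.1]

theorem integral_one_sub_half_pow (m : ℕ) :
    ((m : ℝ) + 1) * ∫ x in (0 : ℝ)..1, (1 - x / 2) ^ m = 2 - (1 / 2) ^ m := by
  have h : ∫ x in (0 : ℝ)..1, (1 - x / 2) ^ m = 2 * ∫ u in (1 / 2 : ℝ)..1, u ^ m := by
    have := intervalIntegral.integral_comp_sub_div (a := 0) (b := 1) (fun u : ℝ => u ^ m)
      (c := 2) two_ne_zero 1
    rw [this, smul_eq_mul]
    norm_num
  rw [h, integral_pow]
  have : (m : ℝ) + 1 ≠ 0 := by positivity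
  field_simp
  ring

theorem not_subtreeSizeConverges_permuton2 : ¬ SubtreeSizeConverges permuton2 := by
  rintro ⟨ν, -, hν⟩
  have h := (hν evalLeftLeft).comp (tendsto_add_atTop_nat 2)
  set L := ∫ ψ, evalLeftLeft ψ ∂ν
  have hhalf : permuton2 {q | ¬ q.1 < 1 / 2} = 1 / 2 := by
    have := isPermuton_permuton2.measure_fst (measurableSet_Ici (a := (1 / 2 : ℝ)))
    rw [unifI, Measure.restrict_apply measurableSet_Ici] at this
    have hs : Set.Ici (1 / 2 : ℝ) ∩ Set.Icc 0 1 = Set.Icc (1 / 2) 1 := by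
      ext y
      simp only [Set.mem_inter_iff, Set.mem_Ici, Set.mem_Icc]
      exact ⟨fun h => ⟨h.1, h.2.2⟩, fun h => ⟨h.1, by linarith [h.1], h.2⟩⟩
    rw [hs, Real.volume_Icc] at this
    simp only [not_lt]
    refine this.trans ?_
    rw [show (1 : ℝ) - 1 / 2 = 1 / 2 by norm_num, ENNReal.ofReal_div_of_pos two_pos]
    simp
  have h0 : ∀ x, permuton2 {q | q.1 = x} = 0 := fun x => by
    have := isPermuton_permuton2.measure_fst (measurableSet_singleton x)
    simpa using this
  let I : ℕ → ℝ := fun m => ∫ x in (0 : ℝ)..1, (1 - x / 2) ^ m * (1 / 2 - densityDev x / 4)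
  let D : ℕ → ℝ := fun m => ∫ x in (0 : ℝ)..1, (1 - x / 2) ^ m * densityDev x
  have e1 : Tendsto (fun m : ℕ => ∫ ψ, evalLeftLeft ψ ∂(subtreeProfileLaw permuton2 (m + 2)) -
      (m + 1) * leftmostPairProb permuton2 m) atTop (𝓝 0) := by
    have hb : Tendsto (fun m : ℕ => ((m : ℝ) * (1 / 2) ^ m + 3 * (1 / 2) ^ m) / 4) atTop
        (𝓝 ((0 + 3 * 0) / 4)) :=
      ((tendsto_self_mul_const_pow_of_lt_one (by norm_num) (by norm_num)).add
        ((tendsto_pow_atTop_nhds_zero_of_lt_one (by norm_num) (by norm_num)).const_mul 3)).div_const 4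
    norm_num at hb
    refine squeeze_zero_norm (fun m => ?_) hb
    rw [integral_evalLeftLeft, Real.norm_eq_abs]
    refine (abs_integral_subtreeProfile_sub_le ae_isSupported_permuton2 h0 hhalf m).trans_eq ?_
    ring
  have e2 : Tendsto (fun m : ℕ => ((m : ℝ) + 1) * leftmostPairProb permuton2 m -
      (m + 1) * (1 / 4 * I m)) atTop (𝓝 0) := by
    refine squeeze_zero_norm (fun m => ?_) tendsto_one_div_add_atTop_nhds_zero_nat
    rw [← mul_sub, norm_mul, Real.norm_eq_abs, Real.norm_eq_abs, abs_of_nonneg (by positivity)]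
    calc _ ≤ ((m : ℝ) + 1) * (1 / ((m + 1) * (m + 2))) := by
          gcongr
          exact abs_leftmostPairProb_sub_le m
      _ = 1 / ((m : ℝ) + 2) := by field_simp
      _ ≤ _ := by gcongr; norm_num
  have e3 : Tendsto (fun m : ℕ => ((m : ℝ) + 1) * I m) atTop (𝓝 (4 * (L - 0 - 0))) := by
    refine (((h.sub e1).sub e2).const_mul 4).congr fun m => ?_
    simp only [Function.comp_apply]
    ring
  -- `I m` is affine in `D m` with an explicit constant term, so a limit for `(m + 1) * I m` would
  -- give one for `(m + 1) * D m`, contradicting the oscillation.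
  have hID : ∀ m : ℕ, ((m : ℝ) + 1) * D m = 2 * (2 - (1 / 2) ^ m) - 4 * (((m : ℝ) + 1) * I m) := by
    intro m
    have hi : IntervalIntegrable densityDev volume 0 1 := by
      rw [intervalIntegrable_iff_integrableOn_Icc_of_le zero_le_one]
      exact integrable_densityDev
    have : I m = 1 / 2 * (∫ x in (0 : ℝ)..1, (1 - x / 2) ^ m) - 1 / 4 * D m := by
      simp only [I, D]
      rw [← intervalIntegral.integral_const_mul, ← intervalIntegral.integral_const_mul,
        ← intervalIntegral.integral_sub]
      · refine intervalIntegral.integral_congr fun x _ => ?_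
        ring
      · exact Continuous.intervalIntegrable (by fun_prop) _ _
      · exact (hi.continuousOn_mul (by fun_prop)).const_mul _
    rw [this, ← integral_one_sub_half_pow m]
    ring
  refine not_tendsto_integral_one_sub_half_pow measurable_densityDev abs_densityDev_le
    (fun x hx => if_pos hx.2) (2 * (2 - 0) - 4 * (4 * (L - 0 - 0))) ?_
  refine Tendsto.congr (fun m => (hID m).symm) ?_
  exact (((tendsto_pow_atTop_nhds_zero_of_lt_one (by norm_num) (by norm_num)).const_sub 2).const_mul
    2).sub (e3.const_mul 4)

theorem proposition5p5 :
    IsPermuton permuton1 ∧ IsPermuton permuton2 ∧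
    permuton2 (segment ℝ ((0 : ℝ), (1 / 2 : ℝ)) ((1 / 2 : ℝ), (1 : ℝ))) = 1 / 2 ∧
    permuton2.restrict (Set.Icc (1 / 2 : ℝ) 1 ×ˢ Set.Icc (0 : ℝ) (1 / 2)) =
      (1 / 2 : ℝ≥0∞) • permuton1.map toLowerRight ∧
    (∀ h : ℝ × ℝ → ℝ, Measurable h → (∃ M : ℝ, ∀ p, |h p| ≤ M) →
      ∫ p, h p ∂permuton2 =
        (∫ t in (0 : ℝ)..(1 / 2), h (t, 1 / 2 + t)) +
          ∫ p, 1 / 2 * h ((p.1 + 1) / 2, p.2 / 2) ∂permuton1) ∧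
    HasLeftEdgeLimit permuton2 (Measure.dirac (1 / 2)) ∧
    ¬ SubtreeSizeConverges permuton2 :=
  ⟨isPermuton_permuton1, isPermuton_permuton2, permuton2_segment, permuton2_restrict,
    integral_permuton2, hasLeftEdgeLimit_permuton2, not_subtreeSizeConverges_permuton2⟩
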